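/- Let $\mathbb{S}^2\subset\mathbb{R}^3$ be the unit sphere, with surface measure $dS$, geodesic distance $d_{\mathbb{S}^2}(x,y)=2\arcsin(\|x-y\|/2)$, tangent planes $\mathcal{T}_x$, surface gradient $\nabla$ and covariant (surface) Hessian $D^2$. Let $f_1,f_2\in C^{1,1}(\mathbb{S}^2)$ with $f_1\ge 0$, $f_2\ge m$ for some constant $m>0$, and $\int_{\mathbb{S}^2}f_1\,dS=\int_{\mathbb{S}^2}f_2\,dS$. Let the cost be either $c(x,y)=\tfrac12 d_{\mathbb{S}^2}(x,y)^2$ or $c(x,y)=-\log\|x-y\|$ (with $c(x,x)=+\infty$). For $x\in\mathbb{S}^2$ and $p\in\mathcal{T}_x$ let $T(x,p)\in\mathbb{S}^2$ be the point determined by $\nabla_x c(x,T(x,p))=-p$, namely $$T(x,p)=\exp_x(p)=\cos(\|p\|)\,x+\sin(\|p\|)\frac{p}{\|p\|}\quad\text{(squared geodesic cost; } T(x,0)=x\text{)},$$ $$T(x,p)=x\,\frac{\|p\|^2-1/4}{\|p\|^2+1/4}-\frac{p}{\|p\|^2+1/4}\quad\text{(logarithmic cost)}$$ (for the squared geodesic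 cost the determining condition concerns $\|p\|<\pi$). Put $$A(x,p)=D^2_{xx}c(x,T(x,p)),\qquad H(x,p)=\bigl|\det D^2_{xy}c(x,T(x,p))\bigr|\,\frac{f_1(x)}{f_2(T(x,p))},$$ $$F(x,p,M)=-\det\bigl(M+A(x,p)\bigr)+H(x,p),\qquad F^+(x,p,M)=-{\det}^+\bigl(M+A(x,p)\bigr)+H(x,p),$$ where $\det^+$ is any function on symmetric matrices with $\det^+(M)=\det M$ if $M$ is positive semidefinite and $\det^+(M)<0$ otherwise. A function $u:\mathbb{S}^2\to\mathbb{R}$ is $c$-convex if there is a function $\psi:\mathbb{S}^2\to\mathbb{R}$ with $u(x)=\sup_{y\in\mathbb{S}^2}\{-c(x,y)-\psi(y)\}$ for all $x\in\mathbb{S}^2$. For $R\in\mathbb{R}$ consider the equations on $\mathbb{S}^2$ $$F(x,\nabla u(x),D^2u(x))=0,\tag{1}$$ $$\max\bigl\{F^+(x,\nabla u(x),D^2u(x)),\ \|\nabla u(x)\|-R\bigr\}=0.\tag{2}$$ **Theorem (equivalence of PDE, smooth case).** (i) For the squared geodesic cost and every $R>\pi$, a $c$-convex function $u\in C^2(\mathbb{S}^2)$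 solves (1) if and only if it solves (2). (ii) For the logarithmic cost there is a constant $C$, depending only on $f_1$ and $f_2$, such that $\|\nabla u\|\le C$ on $\mathbb{S}^2$ for every $c$-convex solution $u\in C^2(\mathbb{S}^2)$ of (1); and for every such constant $C$ and every $R>C$, a $c$-convex function $u\in C^2(\mathbb{S}^2)$ solves (1) if and only if it solves (2). -/

import Mathlib

open MeasureTheory Module
open scoped Manifold ContDiff

noncomputable section

namespace SphereOT

/-- Euclidean three-space. -/
abbrev E3 : Type := EuclideanSpace ℝ (Fin 3)

/-- The unit sphere of `E3`, with Mathlib's smooth structure. -/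
abbrev S2 : Type := Metric.sphere (0 : E3) 1

instance factFinrankE3 : Fact (finrank ℝ E3 = 2 + 1) := ⟨by simp⟩

/-- The tangent plane at `x`: the plane of vectors of `E3` that are orthogonal to `x`. -/
abbrev TanPlane (x : S2) : Type := ((Submodule.span ℝ {(x : E3)})ᗮ : Submodule ℝ E3)

/-- An orthonormal basis of the tangent plane at `x`. -/
def tanBasis (x : S2) : OrthonormalBasis (Fin 2) ℝ (TanPlane x) :=
  OrthonormalBasis.fromOrthogonalSpanSingleton 2 (ne_zero_of_mem_unit_sphere x)

/-- A combination of `x` and a tangent vector `p` at `x` has squared norm `a² + b² |p|²`. -/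
theorem norm_sq_combination (x : S2) (p : TanPlane x) (a b : ℝ) :
    ‖a • (x : E3) + b • (p : E3)‖ ^ 2 = a ^ 2 + b ^ 2 * ‖p‖ ^ 2 := by
  have hx : ‖(x : E3)‖ = 1 := by simp
  have h : inner ℝ (x : E3) (p : E3) = 0 :=
    Submodule.mem_orthogonal_singleton_iff_inner_right.mp p.2
  rw [norm_add_sq_real, norm_smul, norm_smul, inner_smul_left, inner_smul_right, h, hx]
  simp [mul_pow]

/-- The exponential map of the unit sphere: `exp_x(p) = cos |p| x + sin |p| (p / |p|)`
(`Real.sinc t = sin t / t`, with value `1` at `t = 0`). -/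
def expMap (x : S2) (p : TanPlane x) : S2 :=
  ⟨Real.cos ‖p‖ • (x : E3) + Real.sinc ‖p‖ • (p : E3), by
    have h := norm_sq_combination x p (Real.cos ‖p‖) (Real.sinc ‖p‖)
    have h1 : Real.sinc ‖p‖ ^ 2 * ‖p‖ ^ 2 = Real.sin ‖p‖ ^ 2 := by
      by_cases hp : ‖p‖ = 0
      · simp [hp]
      · rw [Real.sinc_of_ne_zero hp]; field_simp
    rw [h1, Real.cos_sq_add_sin_sq] at h
    rw [mem_sphere_zero_iff_norm]
    exact (pow_eq_one_iff_of_nonneg (norm_nonneg _) two_ne_zero).mp h⟩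

/-- Surface gradient of `f` at `x`, computed in geodesic normal coordinates centred at `x`. -/
def surfGrad (f : S2 → ℝ) (x : S2) : TanPlane x :=
  gradient (fun v : TanPlane x => f (expMap x v)) 0

/-- Surface (covariant) Hessian of `f` at `x`, as a matrix in an orthonormal basis of the tangent
plane: the Hessian at the centre of geodesic normal coordinates, where the Christoffel symbols
vanish. -/
def surfHess (f : S2 → ℝ) (x : S2) : Matrix (Fin 2) (Fin 2) ℝ :=
  Matrix.of fun i j =>
    fderiv ℝ (fderiv ℝ (fun v : TanPlane x => f (expMap x v))) 0 (tanBasis x i) (tanBasis x j)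

/-- Mixed second derivative `D²_{xy} g (x, y)`, a bilinear form on (tangent plane at `x`) ×
(tangent plane at `y`), as a matrix in orthonormal bases. The absolute value of its determinant
does not depend on the bases. -/
def mixedHess (g : S2 → S2 → ℝ) (x y : S2) : Matrix (Fin 2) (Fin 2) ℝ :=
  Matrix.of fun i j =>
    fderiv ℝ (fun v : TanPlane x =>
      fderiv ℝ (fun w : TanPlane y => g (expMap x v) (expMap y w)) 0 (tanBasis y j)) 0
      (tanBasis x i)

/-- `f` is of class `C²` on the sphere. -/
def IsC2 (f : S2 → ℝ) : Prop := ContMDiff (𝓡 2) 𝓘(ℝ, ℝ) 2 f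

/-- `f` is of class `C^{1,1}` on the sphere: `C¹` with Lipschitz continuous surface gradient
(tangent vectors being regarded as vectors of `E3`). -/
def IsC11 (f : S2 → ℝ) : Prop :=
  ContMDiff (𝓡 2) 𝓘(ℝ, ℝ) 1 f ∧
    ∃ K : NNReal, LipschitzWith K (fun x : S2 => ((surfGrad f x : TanPlane x) : E3))

/-- The surface area measure of the unit sphere. -/
def surfMeasure : Measure S2 := (volume : Measure E3).toSphere

/-- Geodesic distance on the unit sphere. -/
def geoDist (x y : S2) : ℝ := 2 * Real.arcsin (‖(x : E3) - (y : E3)‖ / 2)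

/-- The two cost functions under consideration. -/
inductive Cost : Type
  | sqGeodesic : Cost
  | logarithmic : Cost

/-- The cost `c(x, y)`; for the logarithmic cost the value at `x = y` is `+∞`, which is taken care
of by `Cost.Finite`. -/
def Cost.val : Cost → S2 → S2 → ℝ
  | .sqGeodesic, x, y => 1 / 2 * geoDist x y ^ 2
  | .logarithmic, x, y => -Real.log ‖(x : E3) - (y : E3)‖

/-- The pairs at which the cost is finite: all pairs for the squared geodesic cost, the pairs off
the diagonal for the logarithmic cost. -/
def Cost.Finite : Cost → S2 → S2 → Prop
  | .sqGeodesic, _, _ => True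
  | .logarithmic, x, y => x ≠ y

/-- The map `T(x, p) = x (|p|² - 1/4) / (|p|² + 1/4) - p / (|p|² + 1/4)` of the logarithmic
cost. -/
def logMap (x : S2) (p : TanPlane x) : S2 :=
  ⟨((‖p‖ ^ 2 - 1 / 4) / (‖p‖ ^ 2 + 1 / 4)) • (x : E3)
      + (-1 / (‖p‖ ^ 2 + 1 / 4)) • (p : E3), by
    have h := norm_sq_combination x p ((‖p‖ ^ 2 - 1 / 4) / (‖p‖ ^ 2 + 1 / 4))
      (-1 / (‖p‖ ^ 2 + 1 / 4))
    have h0 : ‖p‖ ^ 2 + 1 / 4 ≠ 0 := by positivity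
    have h1 : ((‖p‖ ^ 2 - 1 / 4) / (‖p‖ ^ 2 + 1 / 4)) ^ 2
        + (-1 / (‖p‖ ^ 2 + 1 / 4)) ^ 2 * ‖p‖ ^ 2 = 1 := by
      field_simp
      ring
    rw [h1] at h
    rw [mem_sphere_zero_iff_norm]
    exact (pow_eq_one_iff_of_nonneg (norm_nonneg _) two_ne_zero).mp h⟩

/-- The map `T(x, p)` of the cost, i.e. the point `T` of the sphere at which
`∇_x c (x, T) = -p` (for the squared geodesic cost this concerns `|p| < π`). -/
def Cost.map : Cost → (x : S2) → TanPlane x → S2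
  | .sqGeodesic, x, p => expMap x p
  | .logarithmic, x, p => logMap x p

/-- `u` is `c`-convex: `u(x) = sup_y (-c(x, y) - ψ(y))` for some function `ψ`. Points `y` with
`c(x, y) = +∞` contribute `-∞` to the supremum and are left out. -/
def CConvex (c : Cost) (u : S2 → ℝ) : Prop :=
  ∃ ψ : S2 → ℝ, ∀ x : S2,
    IsLUB {r : ℝ | ∃ y : S2, c.Finite x y ∧ r = -c.val x y - ψ y} (u x)

/-- `A(x, p) = D²_{xx} c (x, T(x, p))`. -/
def opA (c : Cost) (x : S2) (p : TanPlane x) : Matrix (Fin 2) (Fin 2) ℝ :=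
  surfHess (fun z => c.val z (c.map x p)) x

/-- `H(x, p) = |det D²_{xy} c (x, T(x, p))| f₁(x) / f₂(T(x, p))`. -/
def opH (c : Cost) (f₁ f₂ : S2 → ℝ) (x : S2) (p : TanPlane x) : ℝ :=
  |(mixedHess c.val x (c.map x p)).det| * f₁ x / f₂ (c.map x p)

/-- `F(x, p, M) = -det (M + A(x, p)) + H(x, p)`. -/
def opF (c : Cost) (f₁ f₂ : S2 → ℝ) (x : S2) (p : TanPlane x) (M : Matrix (Fin 2) (Fin 2) ℝ) : ℝ :=
  -(M + opA c x p).det + opH c f₁ f₂ x p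

/-- `d` is a modified determinant `det⁺` on symmetric matrices: it is the determinant on positive
semidefinite matrices, and negative on all other symmetric matrices. -/
def IsDetPlus (d : Matrix (Fin 2) (Fin 2) ℝ → ℝ) : Prop :=
  (∀ M, M.PosSemidef → d M = M.det) ∧ ∀ M, M.IsSymm → ¬ M.PosSemidef → d M < 0

/-- `F⁺(x, p, M) = -det⁺ (M + A(x, p)) + H(x, p)`. -/
def opFPlus (d : Matrix (Fin 2) (Fin 2) ℝ → ℝ) (c : Cost) (f₁ f₂ : S2 → ℝ) (x : S2)
    (p : TanPlane x) (M : Matrix (Fin 2) (Fin 2) ℝ) : ℝ :=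
  -d (M + opA c x p) + opH c f₁ f₂ x p

/-- `u` solves `F(x, ∇u, D²u) = 0` on the sphere. -/
def SolvesOT (c : Cost) (f₁ f₂ u : S2 → ℝ) : Prop :=
  ∀ x : S2, opF c f₁ f₂ x (surfGrad u x) (surfHess u x) = 0

/-- `u` solves `max {F⁺(x, ∇u, D²u), |∇u| - R} = 0` on the sphere. -/
def SolvesModified (d : Matrix (Fin 2) (Fin 2) ℝ → ℝ) (R : ℝ) (c : Cost)
    (f₁ f₂ u : S2 → ℝ) : Prop :=
  ∀ x : S2, max (opFPlus d c f₁ f₂ x (surfGrad u x) (surfHess u x)) (‖surfGrad u x‖ - R) = 0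

/-- `C` bounds the gradient of every `c`-convex `C²` solution of `F = 0`. -/
def IsGradientBound (c : Cost) (f₁ f₂ : S2 → ℝ) (C : ℝ) : Prop :=
  ∀ u : S2 → ℝ, IsC2 u → CConvex c u → SolvesOT c f₁ f₂ u → ∀ x : S2, ‖surfGrad u x‖ ≤ C

end SphereOT

end

open SphereOT

noncomputable section

namespace SphereOT

open Set Filter Topology
open scoped Pointwise ENNReal

/-! Everything rests on contact points. If `u` is `c`-convex, compactness gives for each `x` a point
`y` such that `u + c(·, y)` is minimal at `x`. The first-order condition says `y = T(x, ∇u(x))`, and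
the second-order condition says that `D²u + A` is positive semidefinite. Hence `det⁺` agrees with
`det` at every `c`-convex `C²` function, for both costs, and only the gradient term of (2) remains
to be dealt with.

For the squared geodesic cost, contact with the antipode of `x` would put a cone of slope `π` under
`u` at `x`, which differentiability forbids. So `‖∇u‖ < π` always holds (`sqGeodesic_contact`); for
`R > π` the gradient term is strictly negative and the two equations agree pointwise.

For the logarithmic cost let `T` denote the map `x ↦ T(x, ∇u(x))`. Differentiating `∇u(x) + ∇ₓc(x, T
x) = 0` gives `D²u + A = -(D²ₓᵧc · DT)ᵀ`, so `F = 0` becomes `f₁ = |det DT| f₂(T)` and `F ≤ 0`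
becomes `f₁ ≤ |det DT| f₂(T)` (`opF_eq_zero_iff`, `opF_le_zero_iff`). Equation (2) yields only the
inequality. Since `T` is injective where its Jacobian is nonzero (`eq_of_logTransport_eq`), the
right side has integral at most `∫ f₂ = ∫ f₁`, so by continuity equality holds everywhere
(`jacobian_eq_of_le`).

The gradient bound says that `T x` stays away from `x` (`lt_norm_sub_logTransport`). If `T x₀` were
very close to `x₀`, monotonicity would send every point outside a small cap around `T x₀` into a
small cap around `x₀`. As `T` is onto, the image of the first cap would cover the rest of the
sphere, which is impossible when the Jacobian is bounded by `sup f₁ / m`. -/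

/-! ### Smoothness of the exponential map of the sphere. -/

/-- The imaginary quaternion with given components. -/
def quatOfVec (v : E3) : Quaternion ℝ := ⟨0, v 0, v 1, v 2⟩

/-- The inclusion of `E3` into the imaginary quaternions. -/
def imQuat : E3 →L[ℝ] Quaternion ℝ :=
  LinearMap.toContinuousLinearMap
    { toFun := quatOfVec
      map_add' := fun v w => Quaternion.ext _ _ (by rw [Quaternion.re_add]; simp [quatOfVec])
        (by rw [Quaternion.imI_add]; simp [quatOfVec])
        (by rw [Quaternion.imJ_add]; simp [quatOfVec])
        (by rw [Quaternion.imK_add]; simp [quatOfVec])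
      map_smul' := fun a v => Quaternion.ext _ _ (by rw [Quaternion.re_smul]; simp [quatOfVec])
        (by rw [Quaternion.imI_smul]; simp [quatOfVec])
        (by rw [Quaternion.imJ_smul]; simp [quatOfVec])
        (by rw [Quaternion.imK_smul]; simp [quatOfVec]) }

/-- The vector part of a quaternion. -/
def quatVec : Quaternion ℝ →L[ℝ] E3 :=
  LinearMap.toContinuousLinearMap
    { toFun := fun q => !₂[q.imI, q.imJ, q.imK]
      map_add' := fun v w => by ext i; fin_cases i <;> simp
      map_smul' := fun a v => by ext i; fin_cases i <;> simp }

/-- The scalar part of a quaternion. -/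
def quatRe : Quaternion ℝ →L[ℝ] ℝ :=
  LinearMap.toContinuousLinearMap
    { toFun := fun q => q.re
      map_add' := fun v w => by simp
      map_smul' := fun a v => by simp }

@[simp] theorem quatRe_apply (q : Quaternion ℝ) : quatRe q = q.re := rfl

@[simp] theorem imQuat_re (v : E3) : (imQuat v).re = 0 := rfl

@[simp] theorem quatVec_imQuat (v : E3) : quatVec (imQuat v) = v := by
  ext i; fin_cases i <;> rfl

@[simp] theorem quatVec_coe (r : ℝ) : quatVec (r : Quaternion ℝ) = 0 := by
  ext i; fin_cases i <;> simp [quatVec]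

theorem norm_imQuat (v : E3) : ‖imQuat v‖ = ‖v‖ := by
  rw [← sq_eq_sq₀ (norm_nonneg _) (norm_nonneg _), EuclideanSpace.norm_sq_eq, sq,
    ← Quaternion.normSq_eq_norm_mul_self, Quaternion.normSq_def', Fin.sum_univ_three]
  have h0 : (imQuat v).imI = v 0 := rfl
  have h1 : (imQuat v).imJ = v 1 := rfl
  have h2 : (imQuat v).imK = v 2 := rfl
  simp [h0, h1, h2]

/-- The quaternion exponential packages `cos ‖v‖` and `sinc ‖v‖ • v` into one analytic function.
This yields their smoothness at `v = 0`, where the norm itself is not differentiable. -/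
theorem exp_imQuat (v : E3) : NormedSpace.exp (imQuat v) =
    (Real.cos ‖v‖ : ℝ) + Real.sinc ‖v‖ • imQuat v := by
  rw [Quaternion.exp_of_re_eq_zero _ (imQuat_re v), norm_imQuat]
  by_cases h : ‖v‖ = 0
  · have : v = 0 := norm_eq_zero.mp h
    simp [this]
  · rw [Real.sinc_of_ne_zero h]

theorem quatRe_exp (v : E3) : quatRe (NormedSpace.exp (imQuat v)) = Real.cos ‖v‖ := by
  simp [exp_imQuat]

theorem quatVec_exp (v : E3) : quatVec (NormedSpace.exp (imQuat v)) = Real.sinc ‖v‖ • v := by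
  simp [exp_imQuat]

theorem contDiff_quatExp {n : ℕ∞ω} :
    ContDiff ℝ n (fun q : Quaternion ℝ => NormedSpace.exp q) :=
  contDiff_iff_contDiffAt.mpr fun q => (NormedSpace.exp_analytic (𝕂 := ℝ) q).contDiffAt

/-- The exponential map as a vector-valued function of a vector. -/
def expVec (x v : E3) : E3 := Real.cos ‖v‖ • x + Real.sinc ‖v‖ • v

theorem expVec_eq (x v : E3) : expVec x v =
    quatRe (NormedSpace.exp (imQuat v)) • x + quatVec (NormedSpace.exp (imQuat v)) := by
  rw [quatRe_exp, quatVec_exp, expVec]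

theorem contDiff_expVec {n : ℕ∞ω} (x : E3) : ContDiff ℝ n (expVec x) := by
  have h : expVec x = fun v => quatRe (NormedSpace.exp (imQuat v)) • x
    + quatVec (NormedSpace.exp (imQuat v)) := funext fun v => expVec_eq x v
  rw [h]
  have h1 : ContDiff ℝ n fun v : E3 => NormedSpace.exp (imQuat v) :=
    contDiff_quatExp.comp imQuat.contDiff
  exact ((quatRe.contDiff.comp h1).smul contDiff_const).add (quatVec.contDiff.comp h1)

theorem hasFDerivAt_expVec_zero (x : E3) :
    HasFDerivAt (expVec x) (ContinuousLinearMap.id ℝ E3) 0 := by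
  have h : expVec x = fun v => quatRe (NormedSpace.exp (imQuat v)) • x
    + quatVec (NormedSpace.exp (imQuat v)) := funext fun v => expVec_eq x v
  rw [h]
  have h0 : HasFDerivAt (NormedSpace.exp : Quaternion ℝ → Quaternion ℝ)
      (1 : Quaternion ℝ →L[ℝ] Quaternion ℝ) (imQuat 0) := by
    rw [map_zero]; exact hasFDerivAt_exp_zero
  have h1 : HasFDerivAt (fun v : E3 => NormedSpace.exp (imQuat v)) _ 0 :=
    h0.comp (0 : E3) imQuat.hasFDerivAt
  have h2 := ((quatRe.hasFDerivAt.comp (0 : E3) h1).smul_const x).add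
    (quatVec.hasFDerivAt.comp (0 : E3) h1)
  refine h2.congr_fderiv ?_
  ext v : 1
  simp

theorem coe_expMap (x : S2) (p : TanPlane x) : (expMap x p : E3) = expVec x p := rfl

theorem contDiff_coe_expMap {n : ℕ∞ω} (x : S2) :
    ContDiff ℝ n (fun p : TanPlane x => (expMap x p : E3)) :=
  ContDiff.comp (g := expVec (x : E3)) (f := ⇑(Submodule.subtypeL (Submodule.span ℝ {(x : E3)})ᗮ))
    (contDiff_expVec (x : E3)) (ContinuousLinearMap.contDiff _)

theorem hasFDerivAt_coe_expMap (x : S2) :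
    HasFDerivAt (fun p : TanPlane x => (expMap x p : E3)) (Submodule.subtypeL _) 0 := by
  have h : HasFDerivAt (expVec x) (ContinuousLinearMap.id ℝ E3)
      ((Submodule.subtypeL ((Submodule.span ℝ {(x : E3)})ᗮ)) 0) := by
    rw [map_zero]; exact hasFDerivAt_expVec_zero x
  exact h.comp (0 : TanPlane x) (Submodule.subtypeL _).hasFDerivAt

@[simp] theorem expMap_zero (x : S2) : expMap x 0 = x := by
  ext1; simp [expMap]

theorem inner_tan (x : S2) (p : TanPlane x) : inner ℝ (x : E3) (p : E3) = 0 :=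
  Submodule.mem_orthogonal_singleton_iff_inner_right.mp p.2

theorem norm_S2 (x : S2) : ‖(x : E3)‖ = 1 := by simp

theorem ne_zero_S2 (x : S2) : (x : E3) ≠ 0 := ne_zero_of_mem_unit_sphere x

theorem inner_self_S2 (x : S2) : inner ℝ (x : E3) x = 1 := by
  rw [real_inner_self_eq_norm_sq, norm_S2]; norm_num

/-! ### Extension of functions off the sphere, constant along rays. -/

/-- Radial projection onto the sphere, with an arbitrary value at the origin. -/
def nrm (z : E3) : S2 :=
  ⟨if z = 0 then EuclideanSpace.single 0 1 else ‖z‖⁻¹ • z, by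
    by_cases h : z = 0
    · simp [h]
    · have : ‖z‖ ≠ 0 := norm_ne_zero_iff.mpr h
      simp [h, norm_smul, this]⟩

theorem coe_nrm {z : E3} (h : z ≠ 0) : (nrm z : E3) = ‖z‖⁻¹ • z := by simp [nrm, h]

theorem nrm_coe (x : S2) : nrm (x : E3) = x := by
  ext1; rw [coe_nrm (ne_zero_S2 x)]; simp

theorem norm_smul_nrm {z : E3} (h : z ≠ 0) : ‖z‖ • (nrm z : E3) = z := by
  rw [coe_nrm h, smul_smul, mul_inv_cancel₀ (norm_ne_zero_iff.mpr h), one_smul]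

theorem nrm_smul {z : E3} (h : z ≠ 0) {r : ℝ} (hr : 0 < r) : nrm (r • z) = nrm z := by
  ext1
  rw [coe_nrm h, coe_nrm (smul_ne_zero hr.ne' h), norm_smul, smul_smul, Real.norm_of_nonneg hr.le]
  congr 1
  field_simp

theorem nrm_smul_S2 (x : S2) {r : ℝ} (hr : 0 < r) : nrm (r • (x : E3)) = x := by
  rw [nrm_smul (ne_zero_S2 x) hr, nrm_coe]

theorem measurable_nrm : Measurable nrm := by
  refine Measurable.subtype_mk ?_
  exact Measurable.ite (measurableSet_singleton 0) measurable_const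
    (measurable_norm.inv.smul measurable_id)

/-- This trades calculus on the manifold for calculus on the open set `E3 \ {0}`: radial projection
is smooth there, and remains so as a map into the sphere. -/
theorem contDiffAt_comp_nrm {u : S2 → ℝ} {n : ℕ∞ω} (hu : ContMDiff (𝓡 2) 𝓘(ℝ, ℝ) n u)
    {z : E3} (hz : z ≠ 0) : ContDiffAt ℝ n (fun z => u (nrm z)) z := by
  let O : TopologicalSpace.Opens E3 := ⟨{0}ᶜ, isOpen_compl_singleton⟩
  have h1 : ContMDiff 𝓘(ℝ, E3) 𝓘(ℝ, E3) n (fun w : O => ‖(w : E3)‖⁻¹ • (w : E3)) := by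
    intro w
    have hw : (w : E3) ≠ 0 := w.2
    refine (contMDiffAt_subtype_iff (f := fun w : E3 => ‖w‖⁻¹ • w)).mpr ?_
    refine ContDiffAt.contMDiffAt ?_
    exact ((contDiffAt_norm ℝ hw).inv (norm_ne_zero_iff.mpr hw)).smul contDiffAt_id
  have h2 := ContMDiff.codRestrict_sphere (n := 2) h1 (fun w => by
    have hw : ‖(w : E3)‖ ≠ 0 := norm_ne_zero_iff.mpr w.2
    simp [norm_smul, hw])
  have h3 := (hu.comp h2) ⟨z, hz⟩
  rw [← contMDiffAt_iff_contDiffAt]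
  refine (contMDiffAt_subtype_iff (U := O) (f := fun z => u (nrm z)) (x := ⟨z, hz⟩)).mp ?_
  convert h3 using 1
  funext w
  have hw : (w : E3) ≠ 0 := w.2
  have : nrm w = Set.codRestrict (fun w : O => ‖(w : E3)‖⁻¹ • (w : E3)) (Metric.sphere 0 1)
      (fun w => by
        have hw : ‖(w : E3)‖ ≠ 0 := norm_ne_zero_iff.mpr w.2
        simp [norm_smul, hw]) w := by
    ext1; rw [coe_nrm hw]; rfl
  simp only [Function.comp_apply]
  rw [this]

theorem continuous_of_IsC2 {u : S2 → ℝ} (hu : IsC2 u) : Continuous u := ContMDiff.continuous hu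

theorem contDiffAt_two_comp_nrm {u : S2 → ℝ} (hu : IsC2 u) {z : E3} (hz : z ≠ 0) :
    ContDiffAt ℝ 2 (fun z => u (nrm z)) z := contDiffAt_comp_nrm hu hz

theorem comp_expMap_eq (u : S2 → ℝ) (x : S2) :
    (fun v : TanPlane x => u (expMap x v)) = fun v => (fun z => u (nrm z)) (expMap x v : E3) := by
  funext v; simp only [nrm_coe]

theorem contDiff_comp_expMap {u : S2 → ℝ} (hu : IsC2 u) (x : S2) :
    ContDiff ℝ 2 (fun v : TanPlane x => u (expMap x v)) := by
  rw [comp_expMap_eq, contDiff_iff_contDiffAt]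
  intro v
  exact ContDiffAt.comp (g := fun z => u (nrm z)) (f := fun v : TanPlane x => (expMap x v : E3)) v
    (contDiffAt_two_comp_nrm hu (ne_zero_S2 _)) (contDiff_coe_expMap x).contDiffAt

/-- The gradient of the extension of `u` that is constant along rays. -/
def extGrad (u : S2 → ℝ) (z : E3) : E3 := gradient (fun z => u (nrm z)) z

theorem inner_extGrad_self {u : S2 → ℝ} (hu : IsC2 u) (x : S2) :
    inner ℝ (extGrad u x) (x : E3) = 0 := by
  have hd : DifferentiableAt ℝ (fun z => u (nrm z)) (x : E3) :=
    (contDiffAt_two_comp_nrm hu (ne_zero_S2 x)).differentiableAt (by norm_num)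
  have h1 : inner ℝ (extGrad u x) (x : E3) = fderiv ℝ (fun z => u (nrm z)) (x : E3) x := by
    simp [extGrad, gradient, InnerProductSpace.toDual_symm_apply]
  rw [h1]
  have hl : HasDerivAt (fun t : ℝ => t • (x : E3)) (x : E3) 1 := by
    simpa using (hasDerivAt_id (1 : ℝ)).smul_const (x : E3)
  have hd' : HasFDerivAt (fun z => u (nrm z)) (fderiv ℝ (fun z => u (nrm z)) (x : E3))
    ((1 : ℝ) • (x : E3)) := by rw [one_smul]; exact hd.hasFDerivAt
  have h2 := hd'.comp_hasDerivAt (1 : ℝ) hl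
  have h3 : HasDerivAt ((fun z => u (nrm z)) ∘ fun t : ℝ => t • (x : E3)) 0 1 := by
    refine (hasDerivAt_const (1 : ℝ) (u x)).congr_of_eventuallyEq ?_
    filter_upwards [lt_mem_nhds (zero_lt_one (α := ℝ))] with t ht
    simp [nrm_smul_S2 x ht]
  exact h2.unique h3

/-- The type of `surfGrad u x` varies with `x`, so its dependence on `x` cannot be differentiated
directly. The ambient gradient `extGrad` takes values in the fixed space `E3` and is `C¹`. -/
theorem coe_surfGrad {u : S2 → ℝ} (hu : IsC2 u) (x : S2) :
    ((surfGrad u x : TanPlane x) : E3) = extGrad u x := by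
  have hm : extGrad u x ∈ (Submodule.span ℝ {(x : E3)})ᗮ := by
    rw [Submodule.mem_orthogonal_singleton_iff_inner_left]
    exact inner_extGrad_self hu x
  have : surfGrad u x = ⟨extGrad u x, hm⟩ := by
    refine ext_inner_right ℝ fun a => ?_
    have hd : DifferentiableAt ℝ (fun z => u (nrm z)) (expMap x 0 : E3) :=
      (contDiffAt_two_comp_nrm hu (ne_zero_S2 _)).differentiableAt (by norm_num)
    have h := hd.hasFDerivAt.comp (0 : TanPlane x) (hasFDerivAt_coe_expMap x)
    have h2 := h.fderiv
    rw [Function.comp_def, ← comp_expMap_eq] at h2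
    rw [expMap_zero] at h2
    have e1 : inner ℝ (surfGrad u x) a = fderiv ℝ (fun v : TanPlane x => u (expMap x v)) 0 a := by
      simp only [surfGrad, gradient, InnerProductSpace.toDual_symm_apply]
    have e2 : inner ℝ (extGrad u x) (a : E3) = fderiv ℝ (fun z => u (nrm z)) (x : E3) a := by
      simp only [extGrad, gradient, InnerProductSpace.toDual_symm_apply]
    rw [e1, h2, Submodule.coe_inner, e2]
    rfl
  rw [this]

theorem contDiffAt_extGrad {u : S2 → ℝ} (hu : IsC2 u) {z : E3} (hz : z ≠ 0) :
    ContDiffAt ℝ 1 (extGrad u) z := by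
  have h := (contDiffAt_two_comp_nrm hu hz).fderiv_right (m := 1) (by norm_num)
  exact ((InnerProductSpace.toDual ℝ E3).symm.contDiff.contDiffAt).comp z h

/-! ### First- and second-order conditions at a local minimum. -/

section SecondDerivativeTest

variable {V : Type*} [NormedAddCommGroup V] [NormedSpace ℝ V]

/-- The second derivative at a local minimum is nonnegative. -/
theorem second_fderiv_nonneg_of_isLocalMin {g : V → ℝ} (hg : ContDiffAt ℝ 2 g 0)
    (hmin : IsLocalMin g 0) (v : V) : 0 ≤ fderiv ℝ (fderiv ℝ g) 0 v v := by
  by_contra! hneg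
  have hline : ∀ t : ℝ, HasDerivAt (fun t : ℝ => t • v) v t := fun t => by
    simpa using (hasDerivAt_id t).smul_const v
  have hcont : Tendsto (fun t : ℝ => t • v) (𝓝 0) (𝓝 0) := by
    simpa using (hline 0).continuousAt.tendsto
  have hd1 : ∀ᶠ t : ℝ in 𝓝 0, HasDerivAt (fun t : ℝ => g (t • v)) (fderiv ℝ g (t • v) v) t := by
    have h1 : ∀ᶠ w in 𝓝 (0 : V), DifferentiableAt ℝ g w := by
      filter_upwards [hg.eventually (by simp)] with w hw
      exact hw.differentiableAt (by norm_num)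
    filter_upwards [hcont.eventually h1] with t ht
    exact ht.hasFDerivAt.comp_hasDerivAt t (hline t)
  have hd2 : HasDerivAt (fun t : ℝ => fderiv ℝ g (t • v) v) (fderiv ℝ (fderiv ℝ g) 0 v v) 0 := by
    have h2 : DifferentiableAt ℝ (fderiv ℝ g) ((0 : ℝ) • v) := by
      rw [zero_smul]
      exact (hg.fderiv_right (m := 1) (by norm_num)).differentiableAt (by norm_num)
    have h3 := h2.hasFDerivAt.comp_hasDerivAt (0 : ℝ) (hline 0)
    rw [zero_smul] at h3
    exact (ContinuousLinearMap.apply ℝ ℝ v).hasFDerivAt.comp_hasDerivAt (0 : ℝ) h3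
  have he : deriv (fun t : ℝ => g (t • v)) =ᶠ[𝓝 0] fun t => fderiv ℝ g (t • v) v :=
    hd1.mono fun t ht => ht.deriv
  have hdd : deriv (deriv fun t : ℝ => g (t • v)) 0 = fderiv ℝ (fderiv ℝ g) 0 v v := by
    rw [he.deriv_eq]; exact hd2.deriv
  have hd0 : deriv (fun t : ℝ => g (t • v)) 0 = 0 := by
    rw [he.self_of_nhds]
    simp [hmin.fderiv_eq_zero]
  -- A negative second derivative makes the origin a local maximum along the line as well. The
  -- restriction is then locally constant, so its second derivative vanishes, a contradiction.
  have hlmax : IsLocalMax (fun t : ℝ => g (t • v)) 0 :=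
    isLocalMax_of_deriv_deriv_neg (by rw [hdd]; exact hneg) hd0
      hd1.self_of_nhds.continuousAt
  have hlmin : ∀ᶠ t : ℝ in 𝓝 0, g 0 ≤ g (t • v) := hcont.eventually hmin
  have hconst : (fun t : ℝ => g (t • v)) =ᶠ[𝓝 0] fun _ => g 0 := by
    filter_upwards [hlmax, hlmin] with t h1 h2
    simp only [zero_smul] at h1
    exact le_antisymm h1 h2
  have : deriv (deriv fun t : ℝ => g (t • v)) 0 = 0 := by
    rw [hconst.deriv.deriv_eq]; simp
  rw [hdd] at this
  exact hneg.ne this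

theorem bilin_apply_combination (B : V →L[ℝ] V →L[ℝ] ℝ) (a b : ℝ) (v w : V) :
    B (a • v + b • w) (a • v + b • w)
      = a * a * B v v + a * b * B v w + b * a * B w v + b * b * B w w := by
  simp; ring

theorem second_fderiv_add {g h : V → ℝ} (hg : ContDiffAt ℝ 2 g 0) (hh : ContDiffAt ℝ 2 h 0) :
    fderiv ℝ (fderiv ℝ fun v => g v + h v) 0
      = fderiv ℝ (fderiv ℝ g) 0 + fderiv ℝ (fderiv ℝ h) 0 := by
  have h1 : fderiv ℝ (fun v => g v + h v) =ᶠ[𝓝 0] fun v => fderiv ℝ g v + fderiv ℝ h v := by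
    filter_upwards [hg.eventually (by simp), hh.eventually (by simp)] with w hw hw'
    exact fderiv_fun_add (hw.differentiableAt (by norm_num)) (hw'.differentiableAt (by norm_num))
  rw [h1.fderiv_eq]
  exact fderiv_fun_add
    ((hg.fderiv_right (m := 1) (by norm_num)).differentiableAt (by norm_num))
    ((hh.fderiv_right (m := 1) (by norm_num)).differentiableAt (by norm_num))

end SecondDerivativeTest

/-- With `f = u` and `g = c(·, y)` at a contact point `y`, this is the statement that `D²u + A` is
positive semidefinite. -/
theorem surfHess_add_posSemidef {f g : S2 → ℝ} {x : S2}
    (hf : ContDiffAt ℝ 2 (fun v : TanPlane x => f (expMap x v)) 0)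
    (hg : ContDiffAt ℝ 2 (fun v : TanPlane x => g (expMap x v)) 0)
    (hmin : IsLocalMin (fun v : TanPlane x => f (expMap x v) + g (expMap x v)) 0) :
    (surfHess f x + surfHess g x).PosSemidef := by
  set B := fderiv ℝ (fderiv ℝ fun v : TanPlane x => f (expMap x v) + g (expMap x v)) 0 with hB
  have hc := hf.add hg
  have hM : surfHess f x + surfHess g x = Matrix.of fun i j => B (tanBasis x i) (tanBasis x j) := by
    ext i j
    rw [hB, second_fderiv_add hf hg]
    rfl
  have hsymm : ∀ v w, B v w = B w v := fun v w =>
    (hc.isSymmSndFDerivAt (by simp)) v w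
  rw [hM]
  refine Matrix.PosSemidef.of_dotProduct_mulVec_nonneg ?_ fun a => ?_
  · ext i j
    simp [hsymm (tanBasis x j)]
  · have h := second_fderiv_nonneg_of_isLocalMin hc hmin (∑ i, a i • tanBasis x i)
    refine h.trans_eq ?_
    rw [← hB]
    simp only [Fin.sum_univ_two, bilin_apply_combination, dotProduct, Matrix.mulVec,
      Matrix.of_apply, Pi.star_apply, star_trivial]
    ring

theorem inner_surfGrad (u : S2 → ℝ) (x : S2) (a : TanPlane x) :
    inner ℝ (surfGrad u x) a = fderiv ℝ (fun v : TanPlane x => u (expMap x v)) 0 a := by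
  simp only [surfGrad, gradient, InnerProductSpace.toDual_symm_apply]

/-- At a local minimum of `u + g` the gradient of `u` is determined by the derivative of `g`. -/
theorem inner_surfGrad_of_isLocalMin {u : S2 → ℝ} (hu : IsC2 u) {x : S2} {g : TanPlane x → ℝ}
    {g' : TanPlane x →L[ℝ] ℝ} (hg : HasFDerivAt g g' 0)
    (hmin : IsLocalMin (fun v : TanPlane x => u (expMap x v) + g v) 0) (a : TanPlane x) :
    inner ℝ (surfGrad u x) a = -g' a := by
  rw [inner_surfGrad]
  have h1 := ((contDiff_comp_expMap hu x).differentiable (by norm_num) 0).hasFDerivAt.add hg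
  have h2 := hmin.hasFDerivAt_eq_zero h1
  have h3 := congrArg (fun L : TanPlane x →L[ℝ] ℝ => L a) h2
  simp only [add_apply, zero_apply] at h3
  linarith

/-! ### Inner products and distances on the sphere. -/

/-- The tangential part of a point of the sphere. -/
theorem sub_inner_smul_mem (x y : S2) :
    (y : E3) - inner ℝ (x : E3) (y : E3) • (x : E3) ∈ (Submodule.span ℝ {(x : E3)})ᗮ := by
  rw [Submodule.mem_orthogonal_singleton_iff_inner_right, inner_sub_right, inner_smul_right,
    inner_self_S2]
  ring

def tanPart (x y : S2) : TanPlane x :=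
  ⟨(y : E3) - inner ℝ (x : E3) (y : E3) • (x : E3), sub_inner_smul_mem x y⟩

theorem coe_tanPart (x y : S2) :
    (tanPart x y : E3) = (y : E3) - inner ℝ (x : E3) (y : E3) • (x : E3) := rfl

theorem inner_tanPart (x y : S2) (a : TanPlane x) :
    inner ℝ (tanPart x y) a = inner ℝ (y : E3) (a : E3) := by
  rw [Submodule.coe_inner, coe_tanPart, inner_sub_left, inner_smul_left, inner_tan]
  simp

theorem norm_sq_tanPart (x y : S2) :
    ‖tanPart x y‖ ^ 2 = 1 - inner ℝ (x : E3) (y : E3) ^ 2 := by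
  rw [← real_inner_self_eq_norm_sq, inner_tanPart, coe_tanPart, inner_sub_right,
    inner_smul_right, inner_self_S2, real_inner_comm]
  ring

theorem norm_sub_sq_S2 (x y : S2) :
    ‖(x : E3) - (y : E3)‖ ^ 2 = 2 - 2 * inner ℝ (x : E3) (y : E3) := by
  rw [norm_sub_sq_real, norm_S2, norm_S2]; ring

theorem inner_S2_le_one (x y : S2) : inner ℝ (x : E3) (y : E3) ≤ 1 := by
  simpa using real_inner_le_norm (x : E3) (y : E3)

theorem neg_one_le_inner_S2 (x y : S2) : -1 ≤ inner ℝ (x : E3) (y : E3) := by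
  have h := abs_real_inner_le_norm (x : E3) (y : E3)
  rw [norm_S2, norm_S2, one_mul] at h
  exact (abs_le.mp h).1

theorem inner_S2_eq_one_iff (x y : S2) : inner ℝ (x : E3) (y : E3) = 1 ↔ x = y := by
  rw [inner_eq_one_iff_of_norm_eq_one (norm_S2 x) (norm_S2 y), Subtype.ext_iff]

theorem inner_S2_lt_one {x y : S2} (h : x ≠ y) : inner ℝ (x : E3) (y : E3) < 1 :=
  lt_of_le_of_ne (inner_S2_le_one x y) fun h' => h ((inner_S2_eq_one_iff x y).mp h')

theorem inner_S2_eq_neg_one_iff (x y : S2) :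
    inner ℝ (x : E3) (y : E3) = -1 ↔ (y : E3) = -(x : E3) := by
  have h := inner_eq_one_iff_of_norm_eq_one (𝕜 := ℝ) (x := (x : E3)) (y := -(y : E3)) (norm_S2 x)
    (by rw [norm_neg, norm_S2])
  rw [inner_neg_right] at h
  constructor
  · intro h'
    rw [h.mp (by rw [h']; norm_num), neg_neg]
  · intro h'
    have := h.mpr (by rw [h', neg_neg])
    linarith

/-- If `θ` is the angle between `x` and `y`, half the chord is `sin (θ / 2)`, and `θ / 2` lies in
the range where `arcsin` inverts `sin`. -/
theorem geoDist_eq (x y : S2) : geoDist x y = Real.arccos (inner ℝ (x : E3) (y : E3)) := by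
  set θ := Real.arccos (inner ℝ (x : E3) (y : E3)) with hθ
  have h0 : 0 ≤ θ := Real.arccos_nonneg _
  have hπ : θ ≤ Real.pi := Real.arccos_le_pi _
  have hc : Real.cos θ = inner ℝ (x : E3) (y : E3) :=
    Real.cos_arccos (neg_one_le_inner_S2 x y) (inner_S2_le_one x y)
  have hs : ‖(x : E3) - (y : E3)‖ / 2 = Real.sin (θ / 2) := by
    have hs0 : 0 ≤ Real.sin (θ / 2) :=
      Real.sin_nonneg_of_nonneg_of_le_pi (by linarith) (by linarith)
    rw [← sq_eq_sq₀ (by positivity) hs0, div_pow, norm_sub_sq_S2, ← hc]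
    have h2 : Real.cos θ = 2 * Real.cos (θ / 2) ^ 2 - 1 := by
      rw [← Real.cos_two_mul]; congr 1; ring
    have h3 := Real.sin_sq_add_cos_sq (θ / 2)
    rw [h2]; linarith
  rw [geoDist, hs, Real.arcsin_sin (by linarith) (by linarith)]
  ring

theorem inner_expMap (x y : S2) (v : TanPlane x) : inner ℝ (expMap x v : E3) (y : E3) =
    Real.cos ‖v‖ * inner ℝ (x : E3) (y : E3) + Real.sinc ‖v‖ * inner ℝ (v : E3) (y : E3) := by
  rw [coe_expMap, expVec, inner_add_left, inner_smul_left, inner_smul_left]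
  rfl

theorem hasFDerivAt_inner_expMap (x y : S2) :
    HasFDerivAt (fun v : TanPlane x => inner ℝ (expMap x v : E3) (y : E3))
      (innerSL ℝ (tanPart x y)) 0 := by
  have h := ((innerSL ℝ (y : E3)).hasFDerivAt (x := (expMap x 0 : E3))).comp (0 : TanPlane x)
    (hasFDerivAt_coe_expMap x)
  have h2 : HasFDerivAt (fun v : TanPlane x => inner ℝ (expMap x v : E3) (y : E3))
      ((innerSL ℝ (y : E3)).comp (Submodule.subtypeL _)) 0 := by
    refine h.congr_of_eventuallyEq (Eventually.of_forall fun v => ?_)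
    simp [real_inner_comm]
  refine h2.congr_fderiv ?_
  ext a
  simp only [ContinuousLinearMap.comp_apply, innerSL_apply_apply, inner_tanPart]
  rfl

theorem contDiff_inner_expMap {n : ℕ∞ω} (x y : S2) :
    ContDiff ℝ n (fun v : TanPlane x => inner ℝ (expMap x v : E3) (y : E3)) :=
  (contDiff_coe_expMap x).inner ℝ contDiff_const

theorem continuous_expMap (x : S2) : Continuous (expMap x) :=
  Continuous.subtype_mk (contDiff_coe_expMap (n := 1) x).continuous _

theorem sqGeodesic_val_eq (x y : S2) : Cost.sqGeodesic.val x y =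
    1 / 2 * Real.arccos (inner ℝ (x : E3) (y : E3)) ^ 2 := by
  rw [Cost.val, geoDist_eq]

/-! ### The squared geodesic cost. -/

/-- Near `x` the squared geodesic cost with target `x` is half the squared norm in normal
coordinates. -/
theorem sqGeodesic_expMap_self (x : S2) :
    (fun v : TanPlane x => Cost.sqGeodesic.val (expMap x v) x) =ᶠ[𝓝 0]
      fun v => 1 / 2 * ‖v‖ ^ 2 := by
  filter_upwards [Metric.ball_mem_nhds (0 : TanPlane x) Real.pi_pos] with v hv
  rw [mem_ball_zero_iff] at hv
  rw [sqGeodesic_val_eq, inner_expMap, inner_self_S2, real_inner_comm, inner_tan, mul_zero,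
    add_zero, mul_one, Real.arccos_cos (norm_nonneg v) hv.le]

theorem inner_S2_mem_Ioo {x y : S2} (hxy : x ≠ y) (hanti : (y : E3) ≠ -(x : E3)) :
    -1 < inner ℝ (x : E3) (y : E3) ∧ inner ℝ (x : E3) (y : E3) < 1 :=
  ⟨lt_of_le_of_ne (neg_one_le_inner_S2 x y)
    fun h => hanti ((inner_S2_eq_neg_one_iff x y).mp h.symm), inner_S2_lt_one hxy⟩

/-- `arccos` is singular at `1`, so the case `x = y` is treated separately: there the cost is half
the squared norm in normal coordinates. Elsewhere the inner product lies strictly between `-1` and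
`1`. -/
theorem contDiffAt_sqGeodesic {x y : S2} (hanti : (y : E3) ≠ -(x : E3)) :
    ContDiffAt ℝ 2 (fun v : TanPlane x => Cost.sqGeodesic.val (expMap x v) y) 0 := by
  by_cases hxy : x = y
  · subst hxy
    exact ((contDiff_const.mul (contDiff_norm_sq ℝ)).contDiffAt).congr_of_eventuallyEq
      (sqGeodesic_expMap_self x)
  · obtain ⟨h1, h2⟩ := inner_S2_mem_Ioo hxy hanti
    simp only [sqGeodesic_val_eq]
    refine contDiffAt_const.mul (ContDiffAt.pow ?_ 2)
    refine ContDiffAt.comp (g := Real.arccos)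
      (f := fun v : TanPlane x => inner ℝ (expMap x v : E3) (y : E3)) 0 ?_
      (contDiff_inner_expMap x y).contDiffAt
    rw [expMap_zero]
    exact Real.contDiffAt_arccos h1.ne' h2.ne

theorem hasFDerivAt_sqGeodesic {x y : S2} (hxy : x ≠ y) (hanti : (y : E3) ≠ -(x : E3)) :
    HasFDerivAt (fun v : TanPlane x => Cost.sqGeodesic.val (expMap x v) y)
      (-(Real.arccos (inner ℝ (x : E3) (y : E3)) / √(1 - inner ℝ (x : E3) (y : E3) ^ 2)) •
        innerSL ℝ (tanPart x y)) 0 := by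
  obtain ⟨h1, h2⟩ := inner_S2_mem_Ioo hxy hanti
  have hacos : HasDerivAt (fun s : ℝ => 1 / 2 * Real.arccos s ^ 2)
      (-(Real.arccos (inner ℝ (x : E3) (y : E3)) / √(1 - inner ℝ (x : E3) (y : E3) ^ 2)))
      (inner ℝ (expMap x 0 : E3) (y : E3)) := by
    rw [expMap_zero]
    refine (((Real.hasDerivAt_arccos h1.ne' h2.ne).pow 2).const_mul (1 / 2)).congr_deriv ?_
    simp; ring
  simp only [sqGeodesic_val_eq]
  exact HasDerivAt.comp_hasFDerivAt (h₂ := fun s : ℝ => 1 / 2 * Real.arccos s ^ 2)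
    (f := fun v : TanPlane x => inner ℝ (expMap x v : E3) (y : E3)) 0 hacos
    (hasFDerivAt_inner_expMap x y)

/-- A local contact point of the squared geodesic cost is the exponential of the gradient. -/
theorem expMap_surfGrad_of_isLocalMin {u : S2 → ℝ} (hu : IsC2 u) {x y : S2}
    (hanti : (y : E3) ≠ -(x : E3))
    (hmin : IsLocalMin (fun v : TanPlane x =>
      u (expMap x v) + Cost.sqGeodesic.val (expMap x v) y) 0) :
    expMap x (surfGrad u x) = y ∧ ‖surfGrad u x‖ < Real.pi := by
  by_cases hxy : x = y
  · subst hxy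
    have hg : HasFDerivAt (fun v : TanPlane x => Cost.sqGeodesic.val (expMap x v) x)
        (0 : TanPlane x →L[ℝ] ℝ) 0 := by
      have h := ((hasStrictFDerivAt_norm_sq (0 : TanPlane x)).hasFDerivAt.const_mul
        (1 / 2 : ℝ)).congr_of_eventuallyEq (sqGeodesic_expMap_self x)
      refine h.congr_fderiv ?_
      simp
    have h0 : surfGrad u x = 0 := ext_inner_right ℝ fun a => by
      rw [inner_surfGrad_of_isLocalMin hu hg hmin a]; simp
    rw [h0, expMap_zero, norm_zero]
    exact ⟨rfl, Real.pi_pos⟩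
  · obtain ⟨h1, h2⟩ := inner_S2_mem_Ioo hxy hanti
    have hg := hasFDerivAt_sqGeodesic hxy hanti
    set s := inner ℝ (x : E3) (y : E3) with hs
    set θ := Real.arccos s with hθ
    have hsin : √(1 - s ^ 2) = Real.sin θ := (Real.sin_arccos s).symm
    have hcos : Real.cos θ = s := Real.cos_arccos h1.le h2.le
    have hsin0 : 0 < Real.sin θ := by
      rw [← hsin]; exact Real.sqrt_pos.mpr (by nlinarith)
    have hθ0 : 0 < θ := Real.arccos_pos.mpr h2
    have hθπ : θ < Real.pi := Real.arccos_lt_pi.mpr h1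
    have hgrad : surfGrad u x = (θ / Real.sin θ) • tanPart x y := ext_inner_right ℝ fun a => by
      rw [inner_surfGrad_of_isLocalMin hu hg hmin a, hsin, inner_smul_left]
      simp
    have hnt : ‖tanPart x y‖ = Real.sin θ := by
      rw [← sq_eq_sq₀ (norm_nonneg _) hsin0.le, norm_sq_tanPart, Real.sin_sq, hcos]
    have hnorm : ‖surfGrad u x‖ = θ := by
      rw [hgrad, norm_smul, hnt, Real.norm_of_nonneg (by positivity), div_mul_cancel₀ _ hsin0.ne']
    refine ⟨?_, hnorm ▸ hθπ⟩
    ext1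
    have hnorm' : ‖((surfGrad u x : TanPlane x) : E3)‖ = θ := hnorm
    rw [coe_expMap, expVec, hnorm', hgrad, Real.sinc_of_ne_zero hθ0.ne',
      Submodule.coe_smul, smul_smul, hcos, coe_tanPart]
    have : Real.sin θ / θ * (θ / Real.sin θ) = 1 := by field_simp
    rw [this, one_smul, ← hs, add_sub_cancel]

theorem exists_unit_tan (x : S2) : ∃ v : TanPlane x, ‖v‖ = 1 :=
  ⟨tanBasis x 0, (tanBasis x).norm_eq_one 0⟩

/-- A differentiable function cannot be touched at `x` by the squared geodesic cost whose target
is the antipode of `x`. -/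
theorem not_antipodal_of_isMin {u : S2 → ℝ} (hu : IsC2 u) {x y : S2}
    (hmin : ∀ z, u x + Cost.sqGeodesic.val x y ≤ u z + Cost.sqGeodesic.val z y) :
    (y : E3) ≠ -(x : E3) := by
  intro hanti
  obtain ⟨v, hv⟩ := exists_unit_tan x
  have hc : ∀ w : TanPlane x, ‖w‖ ≤ Real.pi → Cost.sqGeodesic.val (expMap x w) y
      = 1 / 2 * (Real.pi - ‖w‖) ^ 2 := fun w hw => by
    rw [sqGeodesic_val_eq, inner_expMap, hanti, inner_neg_right, inner_neg_right, inner_self_S2,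
      real_inner_comm, inner_tan, neg_zero, mul_zero, add_zero, mul_neg, mul_one, Real.arccos_neg,
      Real.arccos_cos (norm_nonneg w) hw]
  have h0 := hc 0 (by simpa using Real.pi_pos.le)
  rw [expMap_zero, norm_zero, sub_zero] at h0
  have hd : Differentiable ℝ fun w : TanPlane x => u (expMap x w) :=
    (contDiff_comp_expMap hu x).differentiable (by norm_num)
  have hl : ∀ w : TanPlane x, HasDerivAt (fun t : ℝ => u (expMap x (t • w)))
      (fderiv ℝ (fun w : TanPlane x => u (expMap x w)) 0 w) 0 := fun w => by
    have h1 : HasDerivAt (fun t : ℝ => t • w) w 0 := by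
      simpa using (hasDerivAt_id (0 : ℝ)).smul_const w
    have h2 := (hd ((0 : ℝ) • w)).hasFDerivAt.comp_hasDerivAt (0 : ℝ) h1
    rw [zero_smul] at h2
    exact h2
  -- The linear terms along `v` and `-v` cancel, so `u(exp tv) + u(exp(-tv)) - 2u(x)` is `o(t)`.
  -- Contact with the antipode forces it to be at least `2πt - t²`, which exceeds `t` for `0 < t ≤
  -- 1`.
  have hk := (hl v).add (hl (-v))
  rw [map_neg, add_neg_cancel, hasDerivAt_iff_isLittleO] at hk
  have hb := hk.bound (zero_lt_one)
  obtain ⟨ε, hε, hball⟩ := Metric.eventually_nhds_iff.mp hb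
  set t := min (ε / 2) 1 with ht
  have ht0 : 0 < t := lt_min (by positivity) one_pos
  have ht1 : t ≤ 1 := min_le_right _ _
  have htε : t < ε := (min_le_left _ _).trans_lt (by linarith)
  have hπ := Real.pi_gt_three
  have hb' := hball (y := t) (by rw [Real.dist_eq, sub_zero, abs_of_pos ht0]; exact htε)
  have hn : ‖t • v‖ = t := by rw [norm_smul, hv, Real.norm_of_nonneg ht0.le, mul_one]
  have hn' : ‖t • -v‖ = t := by rw [smul_neg, norm_neg, hn]
  have m1 := hmin (expMap x (t • v))
  have m2 := hmin (expMap x (t • -v))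
  rw [hc _ (by rw [hn]; linarith), hn, h0] at m1
  rw [hc _ (by rw [hn']; linarith), hn', h0] at m2
  simp only [zero_smul, smul_zero, sub_zero, Pi.add_apply, expMap_zero, one_mul] at hb'
  rw [Real.norm_of_nonneg ht0.le] at hb'
  have := (le_abs_self _).trans hb'
  nlinarith

/-- The least upper bound of a set is approached by a sequence in it. -/
theorem exists_seq_of_isLUB {S : Set ℝ} {a : ℝ} (h : IsLUB S a) :
    ∃ r : ℕ → ℝ, (∀ n, r n ∈ S) ∧ ∀ n : ℕ, a - 1 / ((n : ℝ) + 1) < r n := by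
  have : ∀ n : ℕ, ∃ r ∈ S, a - 1 / ((n : ℝ) + 1) < r := fun n =>
    (lt_isLUB_iff h).mp (sub_lt_self _ (by positivity))
  choose r hr hr' using this
  exact ⟨r, hr, hr'⟩

theorem continuous_sqGeodesic : Continuous fun q : S2 × S2 => Cost.sqGeodesic.val q.1 q.2 := by
  simp only [Cost.val, geoDist]
  fun_prop

/-- `ψ` is arbitrary, so the supremum need not be attained. A limit of near-maximizers works
nevertheless: using the same target at `x` and at `z` eliminates `ψ`, and what remains is continuous
in the target. -/
theorem exists_contact_sqGeodesic {u : S2 → ℝ} (hc : CConvex .sqGeodesic u) (x : S2) :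
    ∃ y : S2, ∀ z, u x + Cost.sqGeodesic.val x y ≤ u z + Cost.sqGeodesic.val z y := by
  obtain ⟨ψ, hψ⟩ := hc
  obtain ⟨r, hrS, hr⟩ := exists_seq_of_isLUB (hψ x)
  choose y _ hy using hrS
  obtain ⟨y0, φ, hφ, hlim⟩ := CompactSpace.tendsto_subseq y
  refine ⟨y0, fun z => ?_⟩
  have hval : ∀ w : S2, Tendsto (fun n => Cost.sqGeodesic.val w (y (φ n))) atTop
      (𝓝 (Cost.sqGeodesic.val w y0)) := fun w =>
    ((continuous_sqGeodesic.comp (Continuous.prodMk_right w)).tendsto y0).comp hlim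
  have h1 : Tendsto (fun n => u x - 1 / ((φ n : ℝ) + 1) + Cost.sqGeodesic.val x (y (φ n))) atTop
      (𝓝 (u x - 0 + Cost.sqGeodesic.val x y0)) :=
    (tendsto_const_nhds.sub (tendsto_one_div_add_atTop_nhds_zero_nat.comp hφ.tendsto_atTop)).add
      (hval x)
  have h2 := (hval z).const_add (u z)
  rw [sub_zero] at h1
  refine le_of_tendsto_of_tendsto' h1 h2 fun n => ?_
  have h3 := hr (φ n)
  have h4 := (hψ z).1 ⟨y (φ n), trivial, rfl⟩
  rw [hy (φ n)] at h3
  linarith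

theorem sqGeodesic_contact {u : S2 → ℝ} (hu : IsC2 u) (hc : CConvex .sqGeodesic u) (x : S2) :
    ‖surfGrad u x‖ < Real.pi ∧
      (surfHess u x + opA .sqGeodesic x (surfGrad u x)).PosSemidef := by
  obtain ⟨y, hy⟩ := exists_contact_sqGeodesic hc x
  have hanti := not_antipodal_of_isMin hu hy
  have hmin : IsLocalMin (fun v : TanPlane x =>
      u (expMap x v) + Cost.sqGeodesic.val (expMap x v) y) 0 :=
    Eventually.of_forall fun v => by simpa using hy (expMap x v)
  obtain ⟨hT, hπ⟩ := expMap_surfGrad_of_isLocalMin hu hanti hmin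
  refine ⟨hπ, ?_⟩
  rw [opA, Cost.map, hT]
  exact surfHess_add_posSemidef (contDiff_comp_expMap hu x).contDiffAt
    (contDiffAt_sqGeodesic hanti) hmin

theorem opFPlus_eq {d : Matrix (Fin 2) (Fin 2) ℝ → ℝ} (hd : IsDetPlus d) {c : Cost}
    {f₁ f₂ : S2 → ℝ} {x : S2} {p : TanPlane x} {M : Matrix (Fin 2) (Fin 2) ℝ}
    (h : (M + opA c x p).PosSemidef) : opFPlus d c f₁ f₂ x p M = opF c f₁ f₂ x p M := by
  rw [opFPlus, opF, hd.1 _ h]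

theorem solvesOT_iff_solvesModified_sqGeodesic {d : Matrix (Fin 2) (Fin 2) ℝ → ℝ}
    (hd : IsDetPlus d) (f₁ f₂ : S2 → ℝ) {R : ℝ} (hR : Real.pi < R) {u : S2 → ℝ} (hu : IsC2 u)
    (hc : CConvex .sqGeodesic u) :
    SolvesOT .sqGeodesic f₁ f₂ u ↔ SolvesModified d R .sqGeodesic f₁ f₂ u := by
  refine forall_congr' fun x => ?_
  obtain ⟨hπ, hpsd⟩ := sqGeodesic_contact hu hc x
  rw [opFPlus_eq hd hpsd, max_eq_iff]
  constructor
  · intro h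
    exact Or.inl ⟨h, by rw [h]; linarith⟩
  -- The second alternative, in which the gradient term attains the maximum, would give `‖∇u‖ = R >
  -- π`.
  · rintro (h | h)
    · exact h.1
    · linarith [h.1]

/-! ### The logarithmic cost: contact points and the transport map. -/

theorem logarithmic_val_eq (x y : S2) : Cost.logarithmic.val x y =
    -(1 / 2) * Real.log (2 - 2 * inner ℝ (x : E3) (y : E3)) := by
  rw [Cost.val, ← norm_sub_sq_S2, Real.log_pow]
  push_cast; ring

theorem two_sub_inner_pos {x y : S2} (h : x ≠ y) : 0 < 2 - 2 * inner ℝ (x : E3) (y : E3) := by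
  linarith [inner_S2_lt_one h]

theorem contDiffAt_logarithmic {x y : S2} (hxy : x ≠ y) :
    ContDiffAt ℝ 2 (fun v : TanPlane x => Cost.logarithmic.val (expMap x v) y) 0 := by
  simp only [logarithmic_val_eq]
  refine contDiffAt_const.mul (ContDiffAt.log ?_ ?_)
  · exact contDiffAt_const.sub (contDiffAt_const.mul (contDiff_inner_expMap x y).contDiffAt)
  · rw [expMap_zero]; exact (two_sub_inner_pos hxy).ne'

theorem hasFDerivAt_logarithmic {x y : S2} (hxy : x ≠ y) :
    HasFDerivAt (fun v : TanPlane x => Cost.logarithmic.val (expMap x v) y)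
      ((2 - 2 * inner ℝ (x : E3) (y : E3))⁻¹ • innerSL ℝ (tanPart x y)) 0 := by
  simp only [logarithmic_val_eq]
  have hl : HasDerivAt (fun s : ℝ => -(1 / 2) * Real.log (2 - 2 * s))
      ((2 - 2 * inner ℝ (x : E3) (y : E3))⁻¹) (inner ℝ (expMap x 0 : E3) (y : E3)) := by
    rw [expMap_zero]
    have h0 := two_sub_inner_pos hxy
    have h1 := (((hasDerivAt_id (inner ℝ (x : E3) (y : E3))).const_mul 2).const_sub 2).log
      (by simpa using h0.ne')
    refine (h1.const_mul (-(1 / 2))).congr_deriv ?_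
    simp only [id]
    field_simp
  exact HasDerivAt.comp_hasFDerivAt (h₂ := fun s : ℝ => -(1 / 2) * Real.log (2 - 2 * s))
    (f := fun v : TanPlane x => inner ℝ (expMap x v : E3) (y : E3)) 0 hl
    (hasFDerivAt_inner_expMap x y)

/-- The transport map of the logarithmic cost with potential `u`. -/
def logTransport (u : S2 → ℝ) (x : S2) : S2 := logMap x (surfGrad u x)

/-- The first-order condition gives `∇u`. With `s = ⟨x, y⟩` it has squared norm `(1 + s) / (4(1 -
s))`, which determines `s`; substituting in the formula for `T(x, p)` returns `y`. -/
theorem logTransport_of_isLocalMin {u : S2 → ℝ} (hu : IsC2 u) {x y : S2} (hxy : x ≠ y)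
    (hmin : IsLocalMin (fun v : TanPlane x =>
      u (expMap x v) + Cost.logarithmic.val (expMap x v) y) 0) :
    surfGrad u x = -(2 - 2 * inner ℝ (x : E3) (y : E3))⁻¹ • tanPart x y ∧
      logTransport u x = y := by
  set s := inner ℝ (x : E3) (y : E3) with hs
  have h0 : 0 < 2 - 2 * s := two_sub_inner_pos hxy
  have hgrad : surfGrad u x = -(2 - 2 * s)⁻¹ • tanPart x y := ext_inner_right ℝ fun a => by
    rw [inner_surfGrad_of_isLocalMin hu (hasFDerivAt_logarithmic hxy) hmin a, inner_smul_left]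
    simp [hs]
  refine ⟨hgrad, ?_⟩
  have hsub : (1 - s) ≠ 0 := by intro h; linarith
  have hn : ‖surfGrad u x‖ ^ 2 = (1 + s) / (4 * (1 - s)) := by
    rw [hgrad, norm_smul, mul_pow, norm_sq_tanPart, ← hs, Real.norm_eq_abs, sq_abs]
    have : 2 - 2 * s = 2 * (1 - s) := by ring
    rw [this]
    field_simp
    ring
  have h1 : ‖surfGrad u x‖ ^ 2 + 1 / 4 = 1 / (2 * (1 - s)) := by
    rw [hn]; field_simp; ring
  have h2 : ‖surfGrad u x‖ ^ 2 - 1 / 4 = s / (2 * (1 - s)) := by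
    rw [hn]; field_simp; ring
  ext1
  simp only [logTransport, logMap]
  rw [h1, h2, hgrad, Submodule.coe_smul, coe_tanPart, smul_smul, ← hs]
  have e1 : s / (2 * (1 - s)) / (1 / (2 * (1 - s))) = s := by field_simp
  have e2 : -1 / (1 / (2 * (1 - s))) * -(2 - 2 * s)⁻¹ = 1 := by
    have : 2 - 2 * s = 2 * (1 - s) := by ring
    rw [this]; field_simp
  rw [e1, e2, one_smul, add_sub_cancel]

/-- `x` minimizes `u + c(·, y)` for the logarithmic cost, in multiplicative form. -/
def LogContact (u : S2 → ℝ) (x y : S2) : Prop :=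
  ∀ z : S2, ‖(z : E3) - y‖ * Real.exp (u x) ≤ ‖(x : E3) - y‖ * Real.exp (u z)

theorem exists_ne_S2 (x : S2) : ∃ y : S2, y ≠ x := by
  refine ⟨-x, fun h => ne_zero_S2 x ?_⟩
  have h' : -(x : E3) = x := congrArg Subtype.val h
  have h2 : (2 : ℝ) • (x : E3) = 0 := by
    rw [two_smul]; nth_rewrite 1 [← h']; exact neg_add_cancel _
  exact (smul_eq_zero.mp h2).resolve_left two_ne_zero

theorem norm_sub_pos_S2 {x y : S2} (h : x ≠ y) : 0 < ‖(x : E3) - y‖ :=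
  norm_sub_pos_iff.mpr fun h' => h (Subtype.ext h')

/-- The multiplicative form stays meaningful on the diagonal and excludes it: for `x = y` the right
side vanishes, while any `z ≠ y` makes the left side positive. -/
theorem LogContact.ne {u : S2 → ℝ} {x y : S2} (h : LogContact u x y) : x ≠ y := by
  intro hxy
  obtain ⟨z, hz⟩ := exists_ne_S2 y
  have h1 := h z
  rw [hxy, sub_self, norm_zero, zero_mul] at h1
  have := mul_pos (norm_sub_pos_S2 hz) (Real.exp_pos (u y))
  linarith

theorem LogContact.le {u : S2 → ℝ} {x y z : S2} (h : LogContact u x y) (hz : z ≠ y) :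
    u x + Cost.logarithmic.val x y ≤ u z + Cost.logarithmic.val z y := by
  have h1 := h z
  have p1 := norm_sub_pos_S2 h.ne
  have p2 := norm_sub_pos_S2 hz
  have h2 := Real.log_le_log (mul_pos p2 (Real.exp_pos _)) h1
  rw [Real.log_mul p2.ne' (Real.exp_pos _).ne', Real.log_mul p1.ne' (Real.exp_pos _).ne',
    Real.log_exp, Real.log_exp] at h2
  simp only [Cost.val]
  linarith

theorem LogContact.isLocalMin {u : S2 → ℝ} {x y : S2} (h : LogContact u x y) :
    IsLocalMin (fun v : TanPlane x =>
      u (expMap x v) + Cost.logarithmic.val (expMap x v) y) 0 := by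
  have h1 : ∀ᶠ v in 𝓝 (0 : TanPlane x), expMap x v ≠ y := by
    have : Tendsto (expMap x) (𝓝 0) (𝓝 x) := by
      simpa using (continuous_expMap x).tendsto 0
    exact this.eventually_ne h.ne
  filter_upwards [h1] with v hv
  simpa using h.le hv

theorem LogContact.logTransport_eq {u : S2 → ℝ} (hu : IsC2 u) {x y : S2}
    (h : LogContact u x y) : logTransport u x = y :=
  (logTransport_of_isLocalMin hu h.ne h.isLocalMin).2

/-- As for the squared cost, near-maximizers are passed to a limit. The product form is continuous
in the target, so no a priori separation of the targets from `x` is needed. -/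
theorem exists_logContact {u : S2 → ℝ} (hc : CConvex .logarithmic u) (x : S2) :
    ∃ y, LogContact u x y := by
  obtain ⟨ψ, hψ⟩ := hc
  obtain ⟨r, hrS, hr⟩ := exists_seq_of_isLUB (hψ x)
  choose y hyx hy using hrS
  obtain ⟨y0, φ, hφ, hlim⟩ := CompactSpace.tendsto_subseq y
  refine ⟨y0, fun z => ?_⟩
  have hval : ∀ w : S2, Tendsto (fun n => ‖(w : E3) - y (φ n)‖) atTop (𝓝 ‖(w : E3) - y0‖) :=
    fun w => ((by fun_prop : Continuous fun y : S2 => ‖(w : E3) - y‖).tendsto y0).comp hlim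
  have hη : Tendsto (fun n => Real.exp (u x - 1 / ((φ n : ℝ) + 1))) atTop
      (𝓝 (Real.exp (u x))) := by
    have := tendsto_const_nhds (x := u x) |>.sub
      (tendsto_one_div_add_atTop_nhds_zero_nat (𝕜 := ℝ) |>.comp hφ.tendsto_atTop)
    rw [sub_zero] at this
    exact (Real.continuous_exp.tendsto _).comp this
  refine le_of_tendsto_of_tendsto' ((hval z).mul hη) ((hval x).mul_const (Real.exp (u z)))
    fun n => ?_
  -- When `z` equals the target, `c`-convexity gives no inequality at `z`, but the left side is
  -- zero.
  by_cases hz : z = y (φ n)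
  · rw [hz, sub_self, norm_zero, zero_mul]; positivity
  · have p1 := norm_sub_pos_S2 (hyx (φ n))
    have p2 := norm_sub_pos_S2 hz
    rw [← Real.log_le_log_iff (by positivity) (by positivity), Real.log_mul p2.ne' (by positivity),
      Real.log_mul p1.ne' (by positivity), Real.log_exp, Real.log_exp]
    have h3 := hr (φ n)
    have h4 := (hψ z).1 ⟨y (φ n), hz, rfl⟩
    rw [hy (φ n)] at h3
    simp only [Cost.val] at h3 h4
    linarith

theorem logContact_logTransport {u : S2 → ℝ} (hu : IsC2 u) (hc : CConvex .logarithmic u)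
    (x : S2) : LogContact u x (logTransport u x) := by
  obtain ⟨y, hy⟩ := exists_logContact hc x
  rwa [hy.logTransport_eq hu]

/-- For each `y`, the function `u + c(·, y)` has a minimizer `x`, found by maximizing `‖z - y‖
e^{-u(z)}`; the first-order condition there gives `T x = y`. -/
theorem surjective_logTransport {u : S2 → ℝ} (hu : IsC2 u) :
    Function.Surjective (logTransport u) := by
  intro y
  have hcu := continuous_of_IsC2 hu
  have hcont : Continuous fun z : S2 => ‖(z : E3) - y‖ * Real.exp (-u z) := by fun_prop
  obtain ⟨x, -, hx⟩ := isCompact_univ.exists_isMaxOn ⟨y, mem_univ y⟩ hcont.continuousOn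
  refine ⟨x, LogContact.logTransport_eq hu fun z => ?_⟩
  have h1 : ‖(z : E3) - y‖ * Real.exp (-u z) ≤ ‖(x : E3) - y‖ * Real.exp (-u x) :=
    hx (mem_univ z)
  have h2 := mul_le_mul_of_nonneg_right h1
    (mul_pos (Real.exp_pos (u z)) (Real.exp_pos (u x))).le
  have e1 : Real.exp (-u z) * Real.exp (u z) = 1 := by rw [← Real.exp_add]; simp
  have e2 : Real.exp (-u x) * Real.exp (u x) = 1 := by rw [← Real.exp_add]; simp
  calc ‖(z : E3) - y‖ * Real.exp (u x)
      = ‖(z : E3) - y‖ * (Real.exp (-u z) * Real.exp (u z)) * Real.exp (u x) := by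
        rw [e1, mul_one]
    _ = ‖(z : E3) - y‖ * Real.exp (-u z) * (Real.exp (u z) * Real.exp (u x)) := by ring
    _ ≤ ‖(x : E3) - y‖ * Real.exp (-u x) * (Real.exp (u z) * Real.exp (u x)) := h2
    _ = ‖(x : E3) - y‖ * (Real.exp (-u x) * Real.exp (u x)) * Real.exp (u z) := by ring
    _ = _ := by rw [e2, mul_one]

theorem logarithmic_posSemidef {u : S2 → ℝ} (hu : IsC2 u) (hc : CConvex .logarithmic u) (x : S2) :
    (surfHess u x + opA .logarithmic x (surfGrad u x)).PosSemidef := by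
  have h := logContact_logTransport hu hc x
  exact surfHess_add_posSemidef (contDiff_comp_expMap hu x).contDiffAt
    (contDiffAt_logarithmic h.ne) h.isLocalMin

/-- Monotonicity of the graph of the transport map. -/
theorem logTransport_monotone {u : S2 → ℝ} (hu : IsC2 u) (hc : CConvex .logarithmic u)
    (x z : S2) :
    ‖(z : E3) - logTransport u x‖ * ‖(x : E3) - logTransport u z‖ ≤
      ‖(x : E3) - logTransport u x‖ * ‖(z : E3) - logTransport u z‖ := by
  have h1 := logContact_logTransport hu hc x z
  have h2 := logContact_logTransport hu hc z x
  -- Multiplying the contact inequalities at `x` and at `z` produces the same factor `e^{u(x)}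
  -- e^{u(z)}` on both sides.
  have h3 := mul_le_mul h1 h2 (by positivity) (by positivity)
  have hp := mul_pos (Real.exp_pos (u x)) (Real.exp_pos (u z))
  refine le_of_mul_le_mul_right ?_ hp
  linarith

/-! ### The homogeneous extension of the transport map and its Jacobian. -/

/-- The degree one homogeneous extension of the transport map. -/
def extTransport (u : S2 → ℝ) (z : E3) : E3 := ‖z‖ • (logTransport u (nrm z) : E3)

theorem extTransport_coe (u : S2 → ℝ) (x : S2) : extTransport u x = logTransport u x := by
  rw [extTransport, norm_S2, nrm_coe, one_smul]

theorem norm_extTransport (u : S2 → ℝ) (z : E3) : ‖extTransport u z‖ = ‖z‖ := by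
  rw [extTransport, norm_smul, norm_S2, norm_norm, mul_one]

theorem extTransport_smul (u : S2 → ℝ) {z : E3} (hz : z ≠ 0) {r : ℝ} (hr : 0 < r) :
    extTransport u (r • z) = r • extTransport u z := by
  rw [extTransport, extTransport, nrm_smul hz hr, norm_smul, Real.norm_of_nonneg hr.le, smul_smul]

theorem coe_logTransport {u : S2 → ℝ} (hu : IsC2 u) (x : S2) : (logTransport u x : E3) =
    ((‖extGrad u x‖ ^ 2 - 1 / 4) / (‖extGrad u x‖ ^ 2 + 1 / 4)) • (x : E3)
      + (-1 / (‖extGrad u x‖ ^ 2 + 1 / 4)) • extGrad u x := by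
  have h : ‖surfGrad u x‖ = ‖extGrad u x‖ := by rw [← coe_surfGrad hu]; rfl
  simp only [logTransport, logMap]
  rw [h, coe_surfGrad hu]

theorem contDiffAt_extTransport {u : S2 → ℝ} (hu : IsC2 u) {z : E3} (hz : z ≠ 0) :
    ContDiffAt ℝ 1 (extTransport u) z := by
  have hN : ContDiffAt ℝ 1 (fun z : E3 => ‖z‖) z := contDiffAt_norm ℝ hz
  have hn : ContDiffAt ℝ 1 (fun z : E3 => ‖z‖⁻¹ • z) z :=
    (hN.inv (norm_ne_zero_iff.mpr hz)).smul contDiffAt_id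
  have hg : ContDiffAt ℝ 1 (fun z : E3 => extGrad u (‖z‖⁻¹ • z)) z :=
    ContDiffAt.comp (g := extGrad u) (f := fun z : E3 => ‖z‖⁻¹ • z) z
      (contDiffAt_extGrad hu (by rw [← coe_nrm hz]; exact ne_zero_S2 _)) hn
  have hg2 := hg.norm_sq ℝ
  have hpos : ‖extGrad u (‖z‖⁻¹ • z)‖ ^ 2 + 1 / 4 ≠ 0 := by positivity
  have h : ContDiffAt ℝ 1 (fun z : E3 => ‖z‖ •
      (((‖extGrad u (‖z‖⁻¹ • z)‖ ^ 2 - 1 / 4) / (‖extGrad u (‖z‖⁻¹ • z)‖ ^ 2 + 1 / 4)) •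
          (‖z‖⁻¹ • z)
        + (-1 / (‖extGrad u (‖z‖⁻¹ • z)‖ ^ 2 + 1 / 4)) • extGrad u (‖z‖⁻¹ • z))) z :=
    hN.smul ((((hg2.sub contDiffAt_const).div (hg2.add contDiffAt_const) hpos).smul hn).add
      ((contDiffAt_const.div (hg2.add contDiffAt_const) hpos).smul hg))
  refine h.congr_of_eventuallyEq ?_
  filter_upwards [isOpen_compl_singleton.mem_nhds hz] with w hw
  simp only [extTransport]
  rw [coe_logTransport hu, coe_nrm hw]

theorem continuous_logTransport {u : S2 → ℝ} (hu : IsC2 u) : Continuous (logTransport u) := by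
  refine continuous_induced_rng.mpr ?_
  have h : (Subtype.val ∘ logTransport u) = fun x : S2 => extTransport u x := by
    funext x; exact (extTransport_coe u x).symm
  rw [h]
  refine continuous_iff_continuousAt.mpr fun x => ?_
  exact ContinuousAt.comp (g := extTransport u)
    (contDiffAt_extTransport hu (ne_zero_S2 x)).continuousAt continuous_subtype_val.continuousAt

/-- The absolute value of the Jacobian determinant of the transport map. -/
def extJac (u : S2 → ℝ) (z : E3) : ℝ := |(fderiv ℝ (extTransport u) z).det|

theorem fderiv_extTransport_smul {u : S2 → ℝ} (hu : IsC2 u) {z : E3} (hz : z ≠ 0) {r : ℝ}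
    (hr : 0 < r) : fderiv ℝ (extTransport u) (r • z) = fderiv ℝ (extTransport u) z := by
  have h1 : HasFDerivAt (extTransport u) (fderiv ℝ (extTransport u) (r • z)) (r • z) :=
    ((contDiffAt_extTransport hu (smul_ne_zero hr.ne' hz)).differentiableAt
      (by norm_num)).hasFDerivAt
  have h2 : HasFDerivAt (fun w : E3 => r⁻¹ • extTransport u (r • w))
      (r⁻¹ • (fderiv ℝ (extTransport u) (r • z)).comp (r • ContinuousLinearMap.id ℝ E3)) z :=
    (h1.comp z ((hasFDerivAt_id z).const_smul r)).const_smul r⁻¹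
  have h3 : extTransport u =ᶠ[𝓝 z] fun w : E3 => r⁻¹ • extTransport u (r • w) := by
    filter_upwards [isOpen_compl_singleton.mem_nhds hz] with w hw
    rw [extTransport_smul u hw hr, smul_smul, inv_mul_cancel₀ hr.ne', one_smul]
  rw [h3.fderiv_eq, h2.fderiv]
  ext v : 1
  simp [smul_smul, hr.ne']

theorem extJac_nrm {u : S2 → ℝ} (hu : IsC2 u) {z : E3} (hz : z ≠ 0) :
    extJac u z = extJac u (nrm z) := by
  rw [extJac, extJac, coe_nrm hz,
    fderiv_extTransport_smul hu hz (inv_pos.mpr (norm_pos_iff.mpr hz))]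

theorem continuousAt_extJac {u : S2 → ℝ} (hu : IsC2 u) {z : E3} (hz : z ≠ 0) :
    ContinuousAt (extJac u) z := by
  have h := ((contDiffAt_extTransport hu hz).fderiv_right (m := 0) (by norm_num)).continuousAt
  exact (ContinuousAt.comp (g := ContinuousLinearMap.det)
    ContinuousLinearMap.continuous_det.continuousAt h).abs

/-! ### From the Monge–Ampère operator to the Jacobian. -/

theorem hasFDerivAt_inner_right {V : Type*} [NormedAddCommGroup V] [NormedSpace ℝ V] {f : V → E3}
    {f' : V →L[ℝ] E3} {v : V} (hf : HasFDerivAt f f' v) (Y : E3) :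
    HasFDerivAt (fun v => inner ℝ (f v) Y) ((innerSL ℝ Y).comp f') v := by
  refine ((innerSL ℝ Y).hasFDerivAt.comp v hf).congr_of_eventuallyEq
    (Eventually.of_forall fun w => ?_)
  simp [real_inner_comm]

theorem hasFDerivAt_inv_two_sub {V : Type*} [NormedAddCommGroup V] [NormedSpace ℝ V] {f : V → ℝ}
    {f' : V →L[ℝ] ℝ} {v : V} (hf : HasFDerivAt f f' v) (h : 2 - 2 * f v ≠ 0) :
    HasFDerivAt (fun v => (2 - 2 * f v)⁻¹) ((2 * (2 - 2 * f v)⁻¹ ^ 2) • f') v := by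
  refine ((hasDerivAt_inv h).comp_hasFDerivAt v ((hf.const_mul 2).const_sub 2)).congr_fderiv ?_
  ext w
  simp
  ring

/-- The mixed second derivative of the logarithmic cost. -/
def logMixed (x y : S2) (a η : E3) : ℝ :=
  (2 - 2 * inner ℝ (x : E3) (y : E3))⁻¹ * inner ℝ a η
    + 2 * (2 - 2 * inner ℝ (x : E3) (y : E3))⁻¹ ^ 2 * inner ℝ a (y : E3) * inner ℝ (x : E3) η

theorem logarithmic_val_comm (x y : S2) :
    Cost.logarithmic.val x y = Cost.logarithmic.val y x := by
  simp only [Cost.val, norm_sub_rev]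

theorem eventually_expMap_ne {x y : S2} (hxy : x ≠ y) :
    ∀ᶠ v in 𝓝 (0 : TanPlane x), expMap x v ≠ y := by
  have : Tendsto (expMap x) (𝓝 0) (𝓝 x) := by simpa using (continuous_expMap x).tendsto 0
  exact this.eventually_ne hxy

theorem mixedHess_logarithmic {x y : S2} (hxy : x ≠ y) (i j : Fin 2) :
    mixedHess Cost.logarithmic.val x y i j = logMixed x y (tanBasis x i) (tanBasis y j) := by
  have h1 : (fun v : TanPlane x => fderiv ℝ (fun w : TanPlane y =>
      Cost.logarithmic.val (expMap x v) (expMap y w)) 0 (tanBasis y j)) =ᶠ[𝓝 0]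
      fun v => (2 - 2 * inner ℝ (expMap x v : E3) (y : E3))⁻¹ *
        inner ℝ (expMap x v : E3) (tanBasis y j : E3) := by
    filter_upwards [eventually_expMap_ne hxy] with v hv
    simp only [logarithmic_val_comm (expMap x v)]
    rw [(hasFDerivAt_logarithmic hv.symm).fderiv, smul_apply,
      innerSL_apply_apply, inner_tanPart, real_inner_comm (expMap x v : E3) (y : E3), smul_eq_mul]
  have hs : (2 - 2 * inner ℝ (expMap x 0 : E3) (y : E3)) ≠ 0 := by
    rw [expMap_zero]; exact (two_sub_inner_pos hxy).ne'
  have h2 := (hasFDerivAt_inv_two_sub (hasFDerivAt_inner_right (hasFDerivAt_coe_expMap x) (y : E3))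
    hs).fun_mul (hasFDerivAt_inner_right (hasFDerivAt_coe_expMap x) (tanBasis y j : E3))
  rw [mixedHess, Matrix.of_apply, h1.fderiv_eq, h2.fderiv, logMixed]
  simp only [expMap_zero, add_apply, smul_apply, ContinuousLinearMap.comp_apply,
    innerSL_apply_apply, Submodule.subtypeL_apply, smul_eq_mul, real_inner_comm (tanBasis x i : E3)]
  ring

theorem inner_fderiv_expMap (x : S2) (v b : TanPlane x) : inner ℝ (expMap x v : E3)
    (fderiv ℝ (fun v : TanPlane x => (expMap x v : E3)) v b) = 0 := by
  have hd := ((contDiff_coe_expMap (n := 1) x).differentiable (by norm_num) v).hasFDerivAt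
  have h1 := hd.inner ℝ hd
  have h2 : HasFDerivAt (fun v : TanPlane x => inner ℝ (expMap x v : E3) (expMap x v : E3))
      (0 : TanPlane x →L[ℝ] ℝ) v := by
    simp only [inner_self_S2]
    exact hasFDerivAt_const _ _
  have h3 := congrArg (fun L : TanPlane x →L[ℝ] ℝ => L b) (h1.unique h2)
  simp only [ContinuousLinearMap.comp_apply, ContinuousLinearMap.prod_apply,
    fderivInnerCLM_apply, zero_apply] at h3
  rw [real_inner_comm] at h3 ⊢
  linarith

/-- The derivative of the logarithmic cost in normal coordinates. -/
def logFirst (x : S2) (b : TanPlane x) (q : TanPlane x × E3) : ℝ :=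
  (2 - 2 * inner ℝ (expMap x q.1 : E3) q.2)⁻¹ *
    inner ℝ q.2 (fderiv ℝ (fun v : TanPlane x => (expMap x v : E3)) q.1 b)

/-- This is the first-order condition at `exp v`, written in the fixed coordinates centred at `x`,
so that it can be differentiated in `v`. The component of the gradient formula along `exp v` drops
out because the derivative of the exponential map is tangent there. -/
theorem fderiv_comp_expMap_add_logFirst {u : S2 → ℝ} (hu : IsC2 u) (hc : CConvex .logarithmic u)
    (x : S2) (v b : TanPlane x) :
    fderiv ℝ (fun v : TanPlane x => u (expMap x v)) v b
      + logFirst x b (v, (logTransport u (expMap x v) : E3)) = 0 := by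
  set z := expMap x v with hz
  have hd := ((contDiff_coe_expMap (n := 1) x).differentiable (by norm_num) v).hasFDerivAt
  have hU := ((contDiffAt_two_comp_nrm hu (ne_zero_S2 z)).differentiableAt
    (by norm_num)).hasFDerivAt
  have h1 := (hU.comp v hd).fderiv
  rw [Function.comp_def, ← comp_expMap_eq] at h1
  have hcon := logContact_logTransport hu hc z
  have hg := congrArg (fun p : TanPlane z => (p : E3))
    (logTransport_of_isLocalMin hu hcon.ne hcon.isLocalMin).1
  rw [coe_surfGrad hu, Submodule.coe_smul, coe_tanPart] at hg
  rw [h1, ContinuousLinearMap.comp_apply]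
  have h2 : ∀ w, fderiv ℝ (fun z => u (nrm z)) (z : E3) w = inner ℝ (extGrad u z) w := fun w => by
    simp only [extGrad, gradient, InnerProductSpace.toDual_symm_apply]
  rw [h2, hg, inner_smul_left, inner_sub_left, inner_smul_left, hz, inner_fderiv_expMap, logFirst]
  simp

theorem fderiv_logarithmic_expMap {x y : S2} (b : TanPlane x) {v : TanPlane x}
    (hv : expMap x v ≠ y) :
    fderiv ℝ (fun v : TanPlane x => Cost.logarithmic.val (expMap x v) y) v b
      = logFirst x b (v, (y : E3)) := by
  have hd := ((contDiff_coe_expMap (n := 1) x).differentiable (by norm_num) v).hasFDerivAt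
  have h0 := two_sub_inner_pos hv
  have h1 := ((((hasFDerivAt_inner_right hd (y : E3)).const_mul 2).const_sub 2).log
    h0.ne').const_mul (-(1 / 2))
  simp only [logarithmic_val_eq]
  rw [h1.fderiv, logFirst]
  simp only [smul_apply, neg_apply, ContinuousLinearMap.comp_apply, innerSL_apply_apply,
    smul_eq_mul]
  ring

theorem differentiableAt_logFirst {x y : S2} (hxy : x ≠ y) (b : TanPlane x) :
    DifferentiableAt ℝ (logFirst x b) (0, (y : E3)) := by
  have he : ContDiffAt ℝ 1 (fun q : TanPlane x × E3 => (expMap x q.1 : E3)) (0, (y : E3)) :=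
    ((contDiff_coe_expMap x).comp contDiff_fst).contDiffAt
  have hd : ContDiff ℝ 1 (fun v : TanPlane x =>
      fderiv ℝ (fun v : TanPlane x => (expMap x v : E3)) v b) :=
    ((contDiff_coe_expMap (n := 2) x).fderiv_right (m := 1) (by norm_num)).clm_apply contDiff_const
  have hd' : ContDiffAt ℝ 1 (fun q : TanPlane x × E3 =>
      fderiv ℝ (fun v : TanPlane x => (expMap x v : E3)) q.1 b) (0, (y : E3)) :=
    (hd.comp contDiff_fst).contDiffAt
  have h : ContDiffAt ℝ 1 (logFirst x b) (0, (y : E3)) := by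
    refine ContDiffAt.mul (ContDiffAt.inv ?_ ?_) (contDiffAt_snd.inner ℝ hd')
    · exact contDiffAt_const.sub (contDiffAt_const.mul (he.inner ℝ contDiffAt_snd))
    · simp only [expMap_zero]; exact (two_sub_inner_pos hxy).ne'
  exact h.differentiableAt (by norm_num)

theorem fderiv_logFirst_snd {x y : S2} (hxy : x ≠ y) (b : TanPlane x) (η : E3) :
    fderiv ℝ (logFirst x b) (0, (y : E3)) (0, η) = logMixed x y b η := by
  have h1 := (differentiableAt_logFirst hxy b).hasFDerivAt.comp (y : E3)
    (hasFDerivAt_prodMk_right (0 : TanPlane x) (y : E3))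
  have hl : HasFDerivAt (fun Y : E3 => inner ℝ Y (x : E3)) (innerSL ℝ (x : E3)) (y : E3) := by
    simpa using hasFDerivAt_inner_right (hasFDerivAt_id (y : E3)) (x : E3)
  have hb : HasFDerivAt (fun Y : E3 => inner ℝ Y (b : E3)) (innerSL ℝ (b : E3)) (y : E3) := by
    simpa using hasFDerivAt_inner_right (hasFDerivAt_id (y : E3)) (b : E3)
  have hs : (2 - 2 * inner ℝ (y : E3) (x : E3)) ≠ 0 := (two_sub_inner_pos hxy.symm).ne'
  have h2 := (hasFDerivAt_inv_two_sub hl hs).mul hb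
  have h3 : (logFirst x b ∘ fun Y : E3 => ((0 : TanPlane x), Y)) =
      (fun Y : E3 => (2 - 2 * inner ℝ Y (x : E3))⁻¹) * fun Y : E3 => inner ℝ Y (b : E3) := by
    funext Y
    simp only [Function.comp_apply, logFirst, expMap_zero, (hasFDerivAt_coe_expMap x).fderiv,
      Pi.mul_apply, real_inner_comm Y (x : E3)]
    rfl
  rw [h3] at h1
  have h4 := congrArg (fun L : E3 →L[ℝ] ℝ => L η) (h1.unique h2)
  simp only [ContinuousLinearMap.comp_apply, ContinuousLinearMap.inr_apply] at h4
  rw [h4, logMixed]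
  simp only [add_apply, smul_apply, innerSL_apply_apply, smul_eq_mul,
    real_inner_comm (x : E3) (y : E3), real_inner_comm (y : E3) (b : E3)]
  ring

/-- The second derivative of `u + c(·, T x)` at `x`, expressed through the derivative of the
transport map `T`. -/
theorem second_fderiv_eq_neg_logMixed {u : S2 → ℝ} (hu : IsC2 u) (hc : CConvex .logarithmic u)
    (x : S2) (a b : TanPlane x) :
    fderiv ℝ (fderiv ℝ fun v : TanPlane x => u (expMap x v)) 0 a b
      + fderiv ℝ (fderiv ℝ fun v : TanPlane x =>
          Cost.logarithmic.val (expMap x v) (logTransport u x)) 0 a b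
      = -logMixed x (logTransport u x) b (fderiv ℝ (extTransport u) (x : E3) a) := by
  set y := logTransport u x with hy
  have hxy : x ≠ y := (logContact_logTransport hu hc x).ne
  have hΦ := (differentiableAt_logFirst hxy b).hasFDerivAt
  set L := fderiv ℝ (logFirst x b) (0, (y : E3)) with hL
  have hτ : HasFDerivAt (fun v : TanPlane x => (logTransport u (expMap x v) : E3))
      ((fderiv ℝ (extTransport u) (x : E3)).comp (Submodule.subtypeL _)) 0 := by
    have h1 : HasFDerivAt (extTransport u) (fderiv ℝ (extTransport u) (x : E3))
        (expMap x 0 : E3) := by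
      rw [expMap_zero]
      exact ((contDiffAt_extTransport hu (ne_zero_S2 x)).differentiableAt
        (by norm_num)).hasFDerivAt
    refine (h1.comp (0 : TanPlane x) (hasFDerivAt_coe_expMap x)).congr_of_eventuallyEq
      (Eventually.of_forall fun v => ?_)
    simp only [Function.comp_apply, extTransport_coe]
  have e1 : fderiv ℝ (fderiv ℝ fun v : TanPlane x => u (expMap x v)) 0 a b
      = -L (a, fderiv ℝ (extTransport u) (x : E3) a) := by
    have hd : HasFDerivAt (fderiv ℝ fun v : TanPlane x => u (expMap x v))
        (fderiv ℝ (fderiv ℝ fun v : TanPlane x => u (expMap x v)) 0) 0 :=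
      (((contDiff_comp_expMap hu x).fderiv_right (m := 1) (by norm_num)).differentiable
        (by norm_num) 0).hasFDerivAt
    have hd2 := (ContinuousLinearMap.apply ℝ ℝ b).hasFDerivAt.comp (0 : TanPlane x) hd
    have hΦ' : HasFDerivAt (logFirst x b) L
        ((fun v : TanPlane x => (v, (logTransport u (expMap x v) : E3))) 0) := by
      simp only [expMap_zero]; exact hΦ
    have h2 := (hΦ'.comp (0 : TanPlane x) ((hasFDerivAt_id (0 : TanPlane x)).prodMk hτ)).neg
    have h3 := (hd2.congr_of_eventuallyEq (f₁ := -(logFirst x b ∘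
      fun v : TanPlane x => (v, (logTransport u (expMap x v) : E3))))
      (Eventually.of_forall fun v => by
        have := fderiv_comp_expMap_add_logFirst hu hc x v b
        simp only [Pi.neg_apply, Function.comp_apply, ContinuousLinearMap.apply_apply]
        linarith)).unique h2
    exact congrArg (fun L : TanPlane x →L[ℝ] ℝ => L a) h3
  have e2 : fderiv ℝ (fderiv ℝ fun v : TanPlane x => Cost.logarithmic.val (expMap x v) y) 0 a b
      = L (a, 0) := by
    have hd : HasFDerivAt (fderiv ℝ fun v : TanPlane x => Cost.logarithmic.val (expMap x v) y)
        (fderiv ℝ (fderiv ℝ fun v : TanPlane x => Cost.logarithmic.val (expMap x v) y) 0) 0 :=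
      (((contDiffAt_logarithmic hxy).fderiv_right (m := 1) (by norm_num)).differentiableAt
        (by norm_num)).hasFDerivAt
    have hd2 := (ContinuousLinearMap.apply ℝ ℝ b).hasFDerivAt.comp (0 : TanPlane x) hd
    have h2 := hΦ.comp (0 : TanPlane x)
      (hasFDerivAt_prodMk_left (𝕜 := ℝ) (0 : TanPlane x) (y : E3))
    have h3 := (hd2.congr_of_eventuallyEq (f₁ := logFirst x b ∘
      fun v : TanPlane x => (v, (y : E3)))
      ((eventually_expMap_ne hxy).mono fun v hv => by
        simp only [Function.comp_apply, ContinuousLinearMap.apply_apply]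
        exact (fderiv_logarithmic_expMap b hv).symm)).unique h2
    exact congrArg (fun L : TanPlane x →L[ℝ] ℝ => L a) h3
  -- The partial derivative with the target frozen is exactly the Hessian of the cost. It cancels,
  -- leaving only the partial derivative in the target.
  have e3 : L (a, fderiv ℝ (extTransport u) (x : E3) a)
      = L (a, 0) + L (0, fderiv ℝ (extTransport u) (x : E3) a) := by
    rw [← map_add]; simp
  rw [e1, e2, e3, hL, fderiv_logFirst_snd hxy]
  ring

theorem inner_fderiv_extTransport {u : S2 → ℝ} (hu : IsC2 u) (x : S2) (a : TanPlane x) :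
    inner ℝ (logTransport u x : E3) (fderiv ℝ (extTransport u) (x : E3) a) = 0 := by
  have hd := ((contDiffAt_extTransport hu (ne_zero_S2 x)).differentiableAt
    (by norm_num)).hasFDerivAt
  have h1 := hd.norm_sq
  have h2 : HasFDerivAt (fun z : E3 => ‖extTransport u z‖ ^ 2) (2 • innerSL ℝ (x : E3)) (x : E3) := by
    simp only [norm_extTransport]
    exact (hasStrictFDerivAt_norm_sq (x : E3)).hasFDerivAt
  have h3 := congrArg (fun L : E3 →L[ℝ] ℝ => L a) (h1.unique h2)
  simp only [smul_apply, ContinuousLinearMap.comp_apply, innerSL_apply_apply, inner_tan,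
    extTransport_coe, smul_zero] at h3
  simpa using h3

theorem fderiv_extTransport_self {u : S2 → ℝ} (hu : IsC2 u) (x : S2) :
    fderiv ℝ (extTransport u) (x : E3) x = logTransport u x := by
  have hd := ((contDiffAt_extTransport hu (ne_zero_S2 x)).differentiableAt
    (by norm_num)).hasFDerivAt
  have hl : HasDerivAt (fun t : ℝ => t • (x : E3)) (x : E3) 1 := by
    simpa using (hasDerivAt_id (1 : ℝ)).smul_const (x : E3)
  have hd' : HasFDerivAt (extTransport u) (fderiv ℝ (extTransport u) (x : E3))
    ((1 : ℝ) • (x : E3)) := by rw [one_smul]; exact hd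
  have h2 := hd'.comp_hasDerivAt (1 : ℝ) hl
  have h3 : HasDerivAt (extTransport u ∘ fun t : ℝ => t • (x : E3)) (logTransport u x : E3) 1 := by
    have h4 : HasDerivAt (fun t : ℝ => t • (logTransport u x : E3)) (logTransport u x : E3) 1 := by
      simpa using (hasDerivAt_id (1 : ℝ)).smul_const (logTransport u x : E3)
    refine h4.congr_of_eventuallyEq ?_
    filter_upwards [lt_mem_nhds (zero_lt_one (α := ℝ))] with t ht
    simp [extTransport_smul u (ne_zero_S2 x) ht, extTransport_coe]
  exact h2.unique h3

/-! ### Determinants in adapted orthonormal frames. -/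

theorem orthonormal_cons_tanBasis (x : S2) :
    Orthonormal ℝ (Fin.cons (x : E3) fun i => (tanBasis x i : E3) : Fin 3 → E3) := by
  rw [orthonormal_iff_ite]
  have h : ∀ i j, inner ℝ (tanBasis x i : E3) (tanBasis x j : E3) = if i = j then 1 else 0 :=
    fun i j => (orthonormal_iff_ite.mp (tanBasis x).orthonormal) i j
  intro i j
  refine Fin.cases ?_ (fun i => ?_) i <;> refine Fin.cases ?_ (fun j => ?_) j
  · simp
  · simp [inner_tan, (Fin.succ_ne_zero j).symm]
  · simp [real_inner_comm (x : E3), inner_tan]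
  · simp [h]

/-- The orthonormal frame of `E3` formed by a point of the sphere and a tangent basis. -/
def frame (x : S2) : OrthonormalBasis (Fin 3) ℝ E3 :=
  OrthonormalBasis.mk (orthonormal_cons_tanBasis x) (by
    have h := (basisOfOrthonormalOfCardEqFinrank (orthonormal_cons_tanBasis x)
      (by simp)).span_eq
    rw [coe_basisOfOrthonormalOfCardEqFinrank] at h
    exact h.ge)

theorem frame_zero (x : S2) : frame x 0 = x := by simp [frame]

theorem frame_succ (x : S2) (i : Fin 2) : frame x i.succ = tanBasis x i := by simp [frame]

/-- The matrix of the derivative of the transport map in orthonormal bases of the tangent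
planes. -/
def transportMatrix (u : S2 → ℝ) (x : S2) : Matrix (Fin 2) (Fin 2) ℝ :=
  Matrix.of fun k i => inner ℝ (tanBasis (logTransport u x) k : E3)
    (fderiv ℝ (extTransport u) (x : E3) (tanBasis x i))

/-- The derivative of the extension sends `x` to `T x` and the tangent plane at `x` into the one at
`T x`. In adapted frames its matrix is therefore block diagonal with a leading `1`. -/
theorem extJac_eq_abs_det {u : S2 → ℝ} (hu : IsC2 u) (x : S2) :
    extJac u x = |(transportMatrix u x).det| := by
  set y := logTransport u x with hy
  set L := fderiv ℝ (extTransport u) (x : E3) with hL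
  have h1 : extJac u x = |LinearMap.det (L : E3 →ₗ[ℝ] E3)| := rfl
  rw [h1, ← LinearMap.normDet_eq_abs_det,
    LinearMap.normDet_eq_norm_det_toMatrix _ (frame x) (frame y), Real.norm_eq_abs]
  congr 1
  have hM : ∀ k i, LinearMap.toMatrix (frame x).toBasis (frame y).toBasis (L : E3 →ₗ[ℝ] E3) k i
      = inner ℝ (frame y k) (L (frame x i)) := fun k i => by
    simp [LinearMap.toMatrix_apply, OrthonormalBasis.repr_apply_apply]
  have hx : L x = y := fderiv_extTransport_self hu x
  have ht : ∀ i, inner ℝ (y : E3) (L (tanBasis x i)) = 0 := fun i =>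
    inner_fderiv_extTransport hu x (tanBasis x i)
  rw [Matrix.det_succ_row_zero, Fin.sum_univ_three]
  have e0 := hM 0 0
  have e1 := hM 0 1
  have e2 := hM 0 2
  rw [frame_zero, frame_zero, hx, inner_self_S2] at e0
  rw [frame_zero, show (1 : Fin 3) = Fin.succ 0 from rfl, frame_succ, ht] at e1
  rw [frame_zero, show (2 : Fin 3) = Fin.succ 1 from rfl, frame_succ, ht] at e2
  rw [e0]
  rw [show (1 : Fin 3) = Fin.succ 0 from rfl, show (2 : Fin 3) = Fin.succ 1 from rfl, e1, e2]
  simp only [Fin.val_zero, pow_zero, mul_one, one_mul, mul_zero, zero_mul, add_zero]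
  congr 1
  ext k i
  rw [Matrix.submatrix_apply, Fin.succAbove_zero, hM, frame_succ, frame_succ]
  rfl

theorem logMixed_sum (x y : S2) (a η : E3) (b : Fin 2 → E3) (c : Fin 2 → ℝ)
    (hη : η = ∑ k, c k • b k) : logMixed x y a η = ∑ k, logMixed x y a (b k) * c k := by
  rw [hη]
  simp only [logMixed, Fin.sum_univ_two, inner_add_right, inner_smul_right]
  ring

theorem mem_orthogonal_fderiv_extTransport {u : S2 → ℝ} (hu : IsC2 u) (x : S2) (a : TanPlane x) :
    fderiv ℝ (extTransport u) (x : E3) a ∈ (Submodule.span ℝ {(logTransport u x : E3)})ᗮ := by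
  rw [Submodule.mem_orthogonal_singleton_iff_inner_right]
  exact inner_fderiv_extTransport hu x a

/-- Expanding the derivative of `T` in the tangent basis at `T x` turns the differentiated
first-order condition into a matrix product. The transpose appears because the direction of
differentiation indexes the columns of `transportMatrix`. -/
theorem surfHess_add_opA_eq {u : S2 → ℝ} (hu : IsC2 u) (hc : CConvex .logarithmic u) (x : S2) :
    surfHess u x + opA .logarithmic x (surfGrad u x) =
      (-(mixedHess Cost.logarithmic.val x (logTransport u x) * transportMatrix u x)).transpose := by
  have hxy : x ≠ logTransport u x := (logContact_logTransport hu hc x).ne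
  ext i j
  have h := second_fderiv_eq_neg_logMixed hu hc x (tanBasis x i) (tanBasis x j)
  rw [logMixed_sum x _ _ _ (fun k => (tanBasis (logTransport u x) k : E3))
    (fun k => transportMatrix u x k i)] at h
  · simp only [Matrix.transpose_apply, Matrix.neg_apply, Matrix.mul_apply, Matrix.add_apply,
      mixedHess_logarithmic hxy]
    exact h
  · have h1 := (tanBasis (logTransport u x)).sum_repr'
      ⟨_, mem_orthogonal_fderiv_extTransport hu x (tanBasis x i)⟩
    have h2 := congrArg (fun p : TanPlane (logTransport u x) => (p : E3)) h1
    simp only [Submodule.coe_sum, Submodule.coe_smul] at h2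
    exact h2.symm

theorem det_mixedHess_ne_zero {x y : S2} (hxy : x ≠ y) :
    (mixedHess Cost.logarithmic.val x y).det ≠ 0 := by
  intro hdet
  obtain ⟨c, hc0, hc⟩ := Matrix.exists_vecMul_eq_zero_iff.mpr hdet
  set a : TanPlane x := ∑ i, c i • tanBasis x i with ha
  set s := inner ℝ (x : E3) (y : E3) with hs
  have h0 : 0 < 2 - 2 * s := two_sub_inner_pos hxy
  have hj : ∀ j, logMixed x y a (tanBasis y j) = 0 := fun j => by
    have h := congrFun hc j
    simp only [Matrix.vecMul, dotProduct, mixedHess_logarithmic hxy, Fin.sum_univ_two,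
      Pi.zero_apply] at h
    rw [← h, ha]
    simp only [logMixed, Fin.sum_univ_two, Submodule.coe_add, Submodule.coe_smul, inner_add_left,
      real_inner_smul_left]
    ring
  set α := inner ℝ (a : E3) (y : E3) with hα
  -- Up to the factor `2(1 - s)²`, `logMixed x y a η` is `⟨w, η⟩`. For `a` in the kernel, `w` is
  -- normal to the tangent plane at `y`, so `w = αy`. Pairing with `x` gives `α = αs`, hence `α = 0`
  -- and then `a = 0`.
  set w : E3 := (1 - s) • (a : E3) + α • (x : E3) with hw
  have hwj : ∀ j, inner ℝ w (tanBasis y j : E3) = 0 := fun j => by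
    have h := hj j
    rw [logMixed, ← hs, ← hα] at h
    rw [hw, inner_add_left, real_inner_smul_left, real_inner_smul_left]
    have h2 : (2 - 2 * s) = 2 * (1 - s) := by ring
    have h3 : (1 - s) ≠ 0 := by intro h; linarith
    rw [h2] at h
    field_simp at h
    linarith
  have hwy : w = inner ℝ (y : E3) w • (y : E3) := by
    have h := (frame y).sum_repr' w
    rw [Fin.sum_univ_succ] at h
    simp only [frame_zero, frame_succ, real_inner_comm w, hwj, zero_smul, Finset.sum_const_zero,
      add_zero] at h
    rw [← h]
    simp [inner_smul_right]
  have hyw : inner ℝ (y : E3) w = α := by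
    rw [hw, inner_add_right, inner_smul_right, inner_smul_right, real_inner_comm,
      real_inner_comm (x : E3) (y : E3), ← hs, ← hα]
    ring
  have hxw : inner ℝ (x : E3) w = α := by
    rw [hw, inner_add_right, inner_smul_right, inner_smul_right, inner_tan, inner_self_S2]
    ring
  rw [hyw] at hwy
  have hα0 : α = 0 := by
    have : inner ℝ (x : E3) w = α * s := by rw [hwy, inner_smul_right]
    rw [hxw] at this
    have h3 : α * (1 - s) = 0 := by linarith
    rcases mul_eq_zero.mp h3 with h | h
    · exact h
    · linarith
  rw [hα0, zero_smul, hw, hα0, zero_smul, add_zero] at hwy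
  have ha0 : a = 0 := by
    rcases smul_eq_zero.mp hwy with h | h
    · linarith
    · exact_mod_cast h
  refine hc0 (funext fun i => ?_)
  have h5 : inner ℝ (tanBasis x i) a = c i := (tanBasis x).orthonormal.inner_right_fintype c i
  rw [ha0, inner_zero_right] at h5
  exact h5.symm

/-- Positive semidefiniteness fixes the sign of the determinant, so absolute values can be taken in
the factorization without loss. -/
theorem det_surfHess_add_opA {u : S2 → ℝ} (hu : IsC2 u) (hc : CConvex .logarithmic u) (x : S2) :
    (surfHess u x + opA .logarithmic x (surfGrad u x)).det =
      |(mixedHess Cost.logarithmic.val x (logTransport u x)).det| * extJac u x := by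
  rw [← abs_of_nonneg (logarithmic_posSemidef hu hc x).det_nonneg, surfHess_add_opA_eq hu hc,
    Matrix.det_transpose, Matrix.det_neg, Matrix.det_mul, extJac_eq_abs_det hu, ← abs_mul]
  simp

theorem opF_eq_zero_iff {u : S2 → ℝ} (hu : IsC2 u) (hc : CConvex .logarithmic u)
    (f₁ : S2 → ℝ) {f₂ : S2 → ℝ} (hf₂ : ∀ y, 0 < f₂ y) (x : S2) :
    opF .logarithmic f₁ f₂ x (surfGrad u x) (surfHess u x) = 0 ↔
      f₁ x = extJac u x * f₂ (logTransport u x) := by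
  have hm := abs_pos.mpr (det_mixedHess_ne_zero (logContact_logTransport hu hc x).ne)
  have h2 := hf₂ (logTransport u x)
  rw [opF, det_surfHess_add_opA hu hc, opH]
  change -(|(mixedHess Cost.logarithmic.val x (logTransport u x)).det| * extJac u x)
    + |(mixedHess Cost.logarithmic.val x (logTransport u x)).det| * f₁ x
      / f₂ (logTransport u x) = 0 ↔ _
  rw [neg_add_eq_zero, eq_div_iff h2.ne', mul_assoc, mul_right_inj' hm.ne', eq_comm]

theorem opF_le_zero_iff {u : S2 → ℝ} (hu : IsC2 u) (hc : CConvex .logarithmic u)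
    (f₁ : S2 → ℝ) {f₂ : S2 → ℝ} (hf₂ : ∀ y, 0 < f₂ y) (x : S2) :
    opF .logarithmic f₁ f₂ x (surfGrad u x) (surfHess u x) ≤ 0 ↔
      f₁ x ≤ extJac u x * f₂ (logTransport u x) := by
  have hm := abs_pos.mpr (det_mixedHess_ne_zero (logContact_logTransport hu hc x).ne)
  have h2 := hf₂ (logTransport u x)
  rw [opF, det_surfHess_add_opA hu hc, opH]
  change -(|(mixedHess Cost.logarithmic.val x (logTransport u x)).det| * extJac u x)
    + |(mixedHess Cost.logarithmic.val x (logTransport u x)).det| * f₁ x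
      / f₂ (logTransport u x) ≤ 0 ↔ _
  rw [neg_add_nonpos_iff, div_le_iff₀ h2, mul_assoc, mul_le_mul_iff_right₀ hm]

/-! ### Surface measure as the measure of cones in the ball. -/

/-- The punctured open unit ball. -/
def pBall : Set E3 := Metric.ball 0 1 \ {0}

theorem isOpen_pBall : IsOpen pBall := Metric.isOpen_ball.sdiff isClosed_singleton

theorem mem_pBall {z : E3} : z ∈ pBall ↔ ‖z‖ < 1 ∧ z ≠ 0 := by
  simp [pBall]

theorem surfMeasure_apply {s : Set S2} (hs : MeasurableSet s) :
    surfMeasure s = 3 * volume (nrm ⁻¹' s ∩ pBall) := by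
  rw [surfMeasure, Measure.toSphere_apply' _ hs]
  have h : Ioo (0 : ℝ) 1 • (Subtype.val '' s : Set E3) = nrm ⁻¹' s ∩ pBall := by
    ext z
    rw [mem_inter_iff, mem_pBall, mem_preimage]
    constructor
    · rintro ⟨r, hr, _, ⟨x, hx, rfl⟩, rfl⟩
      refine ⟨?_, ?_, smul_ne_zero hr.1.ne' (ne_zero_S2 x)⟩
      · simpa only [nrm_smul_S2 x hr.1] using hx
      · simp only [norm_smul, norm_S2, mul_one, Real.norm_of_nonneg hr.1.le]
        exact hr.2
    · rintro ⟨h1, h2, h3⟩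
      exact ⟨‖z‖, ⟨norm_pos_iff.mpr h3, h2⟩, nrm z, ⟨nrm z, h1, rfl⟩, norm_smul_nrm h3⟩
  rw [h]
  simp

theorem surfMeasure_eq :
    surfMeasure = (3 : ℝ≥0∞) • (volume.restrict pBall).map nrm := by
  ext s hs
  rw [surfMeasure_apply hs, Measure.smul_apply, Measure.map_apply measurable_nrm hs,
    Measure.restrict_apply (measurable_nrm hs), smul_eq_mul]

theorem lintegral_surfMeasure {g : S2 → ℝ≥0∞} (hg : Measurable g) :
    ∫⁻ x, g x ∂surfMeasure = 3 * ∫⁻ z in pBall, g (nrm z) := by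
  rw [surfMeasure_eq, lintegral_smul_measure, lintegral_map hg measurable_nrm, smul_eq_mul]

instance : IsFiniteMeasure surfMeasure := by unfold surfMeasure; infer_instance

instance : surfMeasure.IsOpenPosMeasure := by unfold surfMeasure; infer_instance

/-! ### The twist condition and injectivity of the transport map. -/

/-- The difference of the two sides of the twist condition at `z`. -/
def twistVec (x' y : S2) (z : E3) : E3 :=
  (1 - inner ℝ (x' : E3) (y : E3)) • z - (1 - inner ℝ z (y : E3)) • (x' : E3)

theorem inner_twistVec (x' y : S2) (z w : E3) : inner ℝ (twistVec x' y z) w =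
    (1 - inner ℝ (x' : E3) (y : E3)) * inner ℝ z w
      - (1 - inner ℝ z (y : E3)) * inner ℝ (x' : E3) w := by
  rw [twistVec, inner_sub_left, real_inner_smul_left, real_inner_smul_left]

theorem inner_twistVec_sub_nonpos {x' y z Y : S2}
    (h : ‖(z : E3) - y‖ * ‖(x' : E3) - Y‖ ≤ ‖(x' : E3) - y‖ * ‖(z : E3) - Y‖) :
    inner ℝ (twistVec x' y z) ((Y : E3) - y) ≤ 0 := by
  have hsq := pow_le_pow_left₀ (by positivity) h 2
  rw [mul_pow, mul_pow, norm_sub_sq_S2, norm_sub_sq_S2, norm_sub_sq_S2, norm_sub_sq_S2] at hsq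
  rw [inner_sub_right, inner_twistVec, inner_twistVec]
  linarith

/-- Testing with the tangential part of the twist vector shows that this part vanishes, so the
vector equals `(s - s') y`. Pairing with `x` and with `x'` gives `⟨x, x'⟩ = 1 + s - s'` and `⟨x, x'⟩
= 1 + s' - s`, hence `⟨x, x'⟩ = 1`. -/
theorem eq_of_twistVec_nonpos {x x' y : S2} (hx : x ≠ y) (hx' : x' ≠ y)
    (h : ∀ b : TanPlane y, inner ℝ (twistVec x' y x) (b : E3) ≤ 0) : x = x' := by
  set w := twistVec x' y x with hw
  set s := inner ℝ (x : E3) (y : E3) with hs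
  set s' := inner ℝ (x' : E3) (y : E3) with hs'
  have hyw : inner ℝ w (y : E3) = s - s' := by rw [hw, inner_twistVec, ← hs, ← hs']; ring
  have hb := h ⟨w - (s - s') • (y : E3), by
    rw [Submodule.mem_orthogonal_singleton_iff_inner_left, inner_sub_left, real_inner_smul_left,
      inner_self_S2, hyw]; ring⟩
  have hρ : w = (s - s') • (y : E3) := by
    rw [← sub_eq_zero, ← norm_eq_zero, ← sq_eq_zero_iff]
    refine le_antisymm ?_ (sq_nonneg _)
    have e : inner ℝ (y : E3) (w - (s - s') • (y : E3)) = 0 := by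
      rw [inner_sub_right, inner_smul_right, inner_self_S2, real_inner_comm, hyw]; ring
    rw [← real_inner_self_eq_norm_sq]
    nth_rewrite 1 [inner_sub_left]
    rw [real_inner_smul_left, e, mul_zero, sub_zero]
    exact hb
  have i1 : inner ℝ w (x : E3) = (s - s') * s := by
    rw [hρ, real_inner_smul_left, real_inner_comm, ← hs]
  have i2 : inner ℝ w (x' : E3) = (s - s') * s' := by
    rw [hρ, real_inner_smul_left, real_inner_comm, ← hs']
  rw [hw, inner_twistVec, ← hs, ← hs', inner_self_S2] at i1 i2
  rw [real_inner_comm (x : E3) (x' : E3)] at i1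
  set γ := inner ℝ (x : E3) (x' : E3) with hγ
  have hA : s < 1 := inner_S2_lt_one hx
  have hB : s' < 1 := inner_S2_lt_one hx'
  have e1 : γ = 1 - (1 - s) + (1 - s') := by
    have : (1 - s) * (γ - (1 - (1 - s) + (1 - s'))) = 0 := by linarith
    rcases mul_eq_zero.mp this with h | h <;> linarith
  have e2 : γ = 1 - (1 - s') + (1 - s) := by
    have : (1 - s') * (γ - (1 - (1 - s') + (1 - s))) = 0 := by linarith
    rcases mul_eq_zero.mp this with h | h <;> linarith
  exact (inner_S2_eq_one_iff x x').mp (by rw [← hγ]; linarith)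

theorem map_nhds_extTransport {u : S2 → ℝ} (hu : IsC2 u) {x : S2} (hJ : extJac u x ≠ 0) :
    map (extTransport u) (𝓝 (x : E3)) = 𝓝 (logTransport u x : E3) := by
  have hdet : (fderiv ℝ (extTransport u) (x : E3)).det ≠ 0 := fun h => hJ (by simp [extJac, h])
  have hstrict : HasStrictFDerivAt (extTransport u)
      (((fderiv ℝ (extTransport u) (x : E3)).toContinuousLinearEquivOfDetNeZero hdet :
        E3 ≃L[ℝ] E3) : E3 →L[ℝ] E3) (x : E3) := by
    refine ((contDiffAt_extTransport hu (ne_zero_S2 x)).hasStrictFDerivAt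
      (by norm_num)).congr_fderiv ?_
    ext v : 1
    simp
  have hmap := hstrict.map_nhds_eq_of_equiv
  rwa [extTransport_coe] at hmap

theorem hasDerivAt_expMap_line (y : S2) (b : TanPlane y) :
    HasDerivAt (fun t : ℝ => (expMap y (t • b) : E3)) (b : E3) 0 := by
  have h1 : HasDerivAt (fun t : ℝ => t • b) b 0 := by
    simpa using (hasDerivAt_id (0 : ℝ)).smul_const b
  have h2 : HasFDerivAt (fun p : TanPlane y => (expMap y p : E3)) (Submodule.subtypeL _)
      ((0 : ℝ) • b) := by rw [zero_smul]; exact hasFDerivAt_coe_expMap y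
  exact h2.comp_hasDerivAt (0 : ℝ) h1

/-- The transport map is injective at points where its Jacobian does not vanish. -/
theorem eq_of_logTransport_eq {u : S2 → ℝ} (hu : IsC2 u) (hc : CConvex .logarithmic u) {x x' : S2}
    (hJ : extJac u x ≠ 0) (hxx' : logTransport u x' = logTransport u x) : x = x' := by
  have hx := (logContact_logTransport hu hc x).ne
  have hx' := (logContact_logTransport hu hc x').ne
  rw [hxx'] at hx'
  obtain ⟨y, hy⟩ : ∃ y, logTransport u x = y := ⟨_, rfl⟩
  rw [hy] at hx hx' hxx'
  refine eq_of_twistVec_nonpos hx hx' fun b => ?_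
  by_contra! hpos
  -- As the Jacobian at `x` is nonzero, `T` is open there: points `Y = exp_y(tb)` close to `y` are
  -- images of points `z` close to `x`. Monotonicity between `x'` and `z` makes the twist vector at
  -- `z` have nonpositive product with `(Y - y)/t`, which tends to `b`; this contradicts strict
  -- positivity at `x`.
  have hmap := map_nhds_extTransport hu hJ
  rw [hy] at hmap
  have hcont : Continuous fun q : E3 × E3 => inner ℝ (twistVec x' y q.1) q.2 := by
    unfold twistVec; fun_prop
  have hev : ∀ᶠ q in 𝓝 (x : E3) ×ˢ 𝓝 (b : E3), 0 < inner ℝ (twistVec x' y q.1) q.2 := by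
    rw [← nhds_prod_eq]
    exact hcont.continuousAt.eventually (lt_mem_nhds hpos)
  obtain ⟨U, hU, V, hV, hUV⟩ := mem_prod_iff.mp hev
  have hcurve := hasDerivAt_expMap_line y b
  have hslope := hcurve.tendsto_slope_zero_right
  have hlim : Tendsto (fun t : ℝ => (expMap y (t • b) : E3)) (𝓝[>] 0) (𝓝 (y : E3)) := by
    have := hcurve.continuousAt.tendsto
    rw [zero_smul, expMap_zero] at this
    exact this.mono_left nhdsWithin_le_nhds
  have hUy : extTransport u '' U ∈ 𝓝 (y : E3) := by rw [← hmap]; exact image_mem_map hU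
  obtain ⟨t, ⟨ht1, ht2⟩, ht0⟩ :=
    (((hlim.eventually hUy).and (hslope.eventually hV)).and self_mem_nhdsWithin).exists
  obtain ⟨z, hzU, hz⟩ := ht1
  simp only [zero_add, zero_smul, expMap_zero] at ht2
  have ht0' : (0 : ℝ) < t := ht0
  set Y := expMap y (t • b) with hY
  -- The preimage is found in `E3`, but the extension preserves norms, so it lies on the sphere.
  have hznorm : ‖z‖ = 1 := by rw [← norm_extTransport u z, hz, norm_S2]
  obtain ⟨z', rfl⟩ : ∃ z' : S2, (z' : E3) = z := ⟨⟨z, by simpa using hznorm⟩, rfl⟩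
  rw [extTransport_coe] at hz
  have hmono := logTransport_monotone hu hc x' z'
  rw [hz, hxx'] at hmono
  have hlt : 0 < inner ℝ (twistVec x' y z') (t⁻¹ • ((Y : E3) - y)) := hUV (mk_mem_prod hzU ht2)
  rw [inner_smul_right] at hlt
  exact absurd (inner_twistVec_sub_nonpos hmono)
    (pos_of_mul_pos_right hlt (inv_nonneg.mpr ht0'.le)).not_ge

/-! ### Mass balance. -/

theorem nrm_extTransport (u : S2 → ℝ) {z : E3} (hz : z ≠ 0) :
    nrm (extTransport u z) = logTransport u (nrm z) := by
  rw [extTransport, nrm_smul_S2 _ (norm_pos_iff.mpr hz)]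

theorem extTransport_mem_pBall (u : S2 → ℝ) {z : E3} (hz : z ∈ pBall) :
    extTransport u z ∈ pBall := by
  rw [mem_pBall] at hz ⊢
  rw [norm_extTransport]
  refine ⟨hz.1, fun h => hz.2 ?_⟩
  rw [← norm_eq_zero, ← norm_extTransport u, h, norm_zero]

theorem hasFDerivWithinAt_extTransport {u : S2 → ℝ} (hu : IsC2 u) (s : Set E3) {z : E3}
    (hz : z ≠ 0) : HasFDerivWithinAt (extTransport u) (fderiv ℝ (extTransport u) z) s z :=
  ((contDiffAt_extTransport hu hz).differentiableAt (by norm_num)).hasFDerivAt.hasFDerivWithinAt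

/-- The transport map does not increase mass, by injectivity where its Jacobian is nonzero. -/
theorem lintegral_extJac_mul_le {u : S2 → ℝ} (hu : IsC2 u) (hc : CConvex .logarithmic u)
    (g : S2 → ℝ≥0∞) :
    ∫⁻ z in pBall, ENNReal.ofReal (extJac u z) * g (logTransport u (nrm z))
      ≤ ∫⁻ z in pBall, g (nrm z) := by
  set s : Set E3 := pBall ∩ extJac u ⁻¹' {0}ᶜ with hs
  have hso : IsOpen s := by
    refine ContinuousOn.isOpen_inter_preimage (fun z hz => ?_) isOpen_pBall
      isOpen_compl_singleton
    exact (continuousAt_extJac hu (mem_pBall.mp hz).2).continuousWithinAt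
  have hinj : InjOn (extTransport u) s := by
    intro z hz w hw h
    have hz0 := (mem_pBall.mp hz.1).2
    have hw0 := (mem_pBall.mp hw.1).2
    have hn : ‖z‖ = ‖w‖ := by rw [← norm_extTransport u z, h, norm_extTransport]
    have hT : logTransport u (nrm w) = logTransport u (nrm z) := by
      rw [← nrm_extTransport u hz0, ← nrm_extTransport u hw0, h]
    have hJ : extJac u (nrm z) ≠ 0 := by rw [← extJac_nrm hu hz0]; exact hz.2
    rw [← norm_smul_nrm hz0, ← norm_smul_nrm hw0, hn, eq_of_logTransport_eq hu hc hJ hT]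
  have harea := lintegral_image_eq_lintegral_abs_det_fderiv_mul volume hso.measurableSet
    (fun z hz => hasFDerivWithinAt_extTransport hu s (mem_pBall.mp hz.1).2) hinj
    (fun z => g (nrm z))
  have hsub : extTransport u '' s ⊆ pBall := by
    rintro _ ⟨z, hz, rfl⟩
    exact extTransport_mem_pBall u hz.1
  -- Injectivity may fail where the Jacobian vanishes, but the integrand is zero there, so the
  -- change of variables is needed only on `s`.
  have hzero : ∫⁻ z in pBall \ s, ENNReal.ofReal (extJac u z) * g (logTransport u (nrm z)) = 0 := by
    rw [setLIntegral_congr_fun (g := fun _ => 0)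
      (isOpen_pBall.measurableSet.diff hso.measurableSet) fun z hz => ?_]
    · simp
    · have : extJac u z = 0 := by
        by_contra h
        exact hz.2 ⟨hz.1, h⟩
      simp [this]
  calc ∫⁻ z in pBall, ENNReal.ofReal (extJac u z) * g (logTransport u (nrm z))
      = ∫⁻ z in pBall ∩ s, ENNReal.ofReal (extJac u z) * g (logTransport u (nrm z)) := by
        rw [← lintegral_inter_add_sdiff _ pBall hso.measurableSet, hzero, add_zero]
    _ = ∫⁻ z in s, ENNReal.ofReal (extJac u z) * g (logTransport u (nrm z)) := by
        rw [inter_eq_self_of_subset_right inter_subset_left]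
    _ = ∫⁻ z in s, ENNReal.ofReal |(fderiv ℝ (extTransport u) z).det|
          * g (nrm (extTransport u z)) := by
        refine setLIntegral_congr_fun hso.measurableSet fun z hz => ?_
        simp only [extJac, nrm_extTransport u (mem_pBall.mp hz.1).2]
    _ = ∫⁻ z in extTransport u '' s, g (nrm z) := harea.symm
    _ ≤ ∫⁻ z in pBall, g (nrm z) := lintegral_mono_set hsub

theorem continuous_extJac_coe {u : S2 → ℝ} (hu : IsC2 u) :
    Continuous fun x : S2 => extJac u x :=
  continuous_iff_continuousAt.mpr fun x =>
    ContinuousAt.comp (g := extJac u) (continuousAt_extJac hu (ne_zero_S2 x))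
      continuous_subtype_val.continuousAt

theorem integrable_of_continuous {g : S2 → ℝ} (hg : Continuous g) : Integrable g surfMeasure :=
  hg.integrable_of_hasCompactSupport (HasCompactSupport.of_compactSpace g)

theorem integral_extJac_mul_le {u : S2 → ℝ} (hu : IsC2 u) (hc : CConvex .logarithmic u)
    {g : S2 → ℝ} (hg : Continuous g) (hg0 : ∀ x, 0 ≤ g x) :
    ∫ x : S2, extJac u x * g (logTransport u x) ∂surfMeasure ≤ ∫ x, g x ∂surfMeasure := by
  have hc' : Continuous fun x : S2 => extJac u x * g (logTransport u x) :=
    (continuous_extJac_coe hu).mul (hg.comp (continuous_logTransport hu))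
  have hnn : ∀ x : S2, 0 ≤ extJac u x * g (logTransport u x) := fun x =>
    mul_nonneg (abs_nonneg _) (hg0 _)
  have h0 : 0 ≤ ∫ x, g x ∂surfMeasure := integral_nonneg hg0
  rw [← ENNReal.ofReal_le_ofReal_iff h0,
    ofReal_integral_eq_lintegral_ofReal (integrable_of_continuous hc') (Eventually.of_forall hnn),
    ofReal_integral_eq_lintegral_ofReal (integrable_of_continuous hg) (Eventually.of_forall hg0),
    lintegral_surfMeasure hc'.measurable.ennreal_ofReal,
    lintegral_surfMeasure hg.measurable.ennreal_ofReal]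
  gcongr 3 * ?_
  refine le_of_eq_of_le ?_ (lintegral_extJac_mul_le hu hc fun x => ENNReal.ofReal (g x))
  refine setLIntegral_congr_fun isOpen_pBall.measurableSet fun z hz => ?_
  simp only [extJac_nrm hu (mem_pBall.mp hz).2]
  rw [ENNReal.ofReal_mul (p := extJac u (nrm z)) (abs_nonneg _)]

/-- A one-sided Jacobian inequality between densities of equal mass is an equality. -/
theorem jacobian_eq_of_le {u : S2 → ℝ} (hu : IsC2 u) (hc : CConvex .logarithmic u)
    {f₁ f₂ : S2 → ℝ} (h1 : Continuous f₁) (h2 : Continuous f₂) (h20 : ∀ x, 0 ≤ f₂ x)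
    (hmass : ∫ x, f₁ x ∂surfMeasure = ∫ y, f₂ y ∂surfMeasure)
    (hle : ∀ x : S2, f₁ x ≤ extJac u x * f₂ (logTransport u x)) (x : S2) :
    f₁ x = extJac u x * f₂ (logTransport u x) := by
  have hc' : Continuous fun x : S2 => extJac u x * f₂ (logTransport u x) :=
    (continuous_extJac_coe hu).mul (h2.comp (continuous_logTransport hu))
  have hint := integral_extJac_mul_le hu hc h2 h20
  have hsub := integral_sub (integrable_of_continuous hc') (integrable_of_continuous h1)
  have hnn : ∀ x : S2, 0 ≤ extJac u x * f₂ (logTransport u x) - f₁ x := fun x =>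
    sub_nonneg.mpr (hle x)
  have hz : ∫ x : S2, (extJac u x * f₂ (logTransport u x) - f₁ x) ∂surfMeasure = 0 :=
    le_antisymm (by rw [hsub]; linarith) (integral_nonneg hnn)
  rw [integral_eq_zero_iff_of_nonneg hnn (integrable_of_continuous (hc'.sub h1))] at hz
  -- Surface measure charges every nonempty open set, so a continuous function vanishing almost
  -- everywhere vanishes identically.
  have h := congrFun ((hc'.sub h1).ae_eq_iff_eq surfMeasure continuous_zero |>.mp hz) x
  simp only [Pi.zero_apply, Pi.sub_apply] at h
  linarith

/-! ### The gradient bound for the logarithmic cost. -/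

/-- The cone over a spherical cap, within the punctured ball. -/
def capCone (y : S2) (δ : ℝ) : Set E3 := pBall ∩ {z | ‖(nrm z : E3) - y‖ ≤ δ}

theorem measurableSet_capCone (y : S2) (δ : ℝ) : MeasurableSet (capCone y δ) :=
  isOpen_pBall.measurableSet.inter (measurableSet_le
    ((continuous_norm.comp (continuous_subtype_val.sub continuous_const)).measurable.comp
      measurable_nrm) measurable_const)

/-- The cone is covered by `N + 1` balls of radius `2/N` centred on the segment from `0` to `y`, at
spacing `1/N`. Since `N + 1 ≤ 2N`, their relative volume `(N + 1)(2/N)³` is at most `16/N²`. -/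
theorem volume_capCone_le (y : S2) {N : ℕ} (hN : 0 < N) :
    volume (capCone y (1 / N)) ≤
      ENNReal.ofReal (16 / (N : ℝ) ^ 2) * volume (Metric.ball (0 : E3) 1) := by
  have hN' : (0 : ℝ) < N := by exact_mod_cast hN
  have hcov : capCone y (1 / N) ⊆
      ⋃ k ∈ Finset.range (N + 1), Metric.closedBall (((k : ℝ) / N) • (y : E3)) (2 / N) := by
    rintro z ⟨hzB, hz⟩
    rw [mem_pBall] at hzB
    have hz' : ‖(nrm z : E3) - y‖ ≤ 1 / N := hz
    set k := ⌊‖z‖ * N⌋₊ with hk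
    have hk1 : (k : ℝ) ≤ ‖z‖ * N := Nat.floor_le (by positivity)
    have hk2 : ‖z‖ * N < k + 1 := Nat.lt_floor_add_one _
    have hkN : k < N + 1 := by
      have : (k : ℝ) < N + 1 := by nlinarith
      exact_mod_cast this
    simp only [mem_iUnion]
    refine ⟨k, Finset.mem_range.mpr hkN, ?_⟩
    rw [mem_closedBall_iff_norm]
    have e : z - ((k : ℝ) / N) • (y : E3) =
        ‖z‖ • ((nrm z : E3) - y) + (‖z‖ - k / N) • (y : E3) := by
      rw [smul_sub, norm_smul_nrm hzB.2, sub_smul]; abel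
    have hd : |‖z‖ - k / N| ≤ 1 / N := by
      rw [abs_le]
      constructor
      · have : (k : ℝ) / N ≤ ‖z‖ := by rw [div_le_iff₀ hN']; exact hk1
        have : (0 : ℝ) ≤ 1 / N := by positivity
        linarith
      · have : ‖z‖ ≤ (k + 1) / N := by rw [le_div_iff₀ hN']; exact hk2.le
        rw [add_div] at this
        linarith
    rw [e]
    calc _ ≤ ‖‖z‖ • ((nrm z : E3) - y)‖ + ‖(‖z‖ - k / N) • (y : E3)‖ := norm_add_le _ _
      _ = ‖z‖ * ‖(nrm z : E3) - y‖ + |‖z‖ - k / N| := by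
        rw [norm_smul, norm_smul, norm_S2, norm_norm, mul_one, Real.norm_eq_abs]
      _ ≤ 1 * (1 / N) + 1 / N := by
        gcongr
        exact hzB.1.le
      _ = 2 / N := by ring
  calc volume (capCone y (1 / N))
      ≤ ∑ k ∈ Finset.range (N + 1),
          volume (Metric.closedBall (((k : ℝ) / N) • (y : E3)) (2 / N)) :=
        (measure_mono hcov).trans (measure_biUnion_finset_le _ _)
    _ = ((N : ℝ≥0∞) + 1) * (ENNReal.ofReal ((2 / N) ^ 3) * volume (Metric.ball (0 : E3) 1)) := by
        have hr : (0 : ℝ) ≤ 2 / N := by positivity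
        simp only [Measure.addHaar_closedBall _ _ hr, finrank_euclideanSpace, Fintype.card_fin,
          Finset.sum_const, Finset.card_range, nsmul_eq_mul, Nat.cast_add, Nat.cast_one]
    _ ≤ _ := by
        rw [← mul_assoc]
        gcongr
        rw [show ((N : ℝ≥0∞) + 1) = ENNReal.ofReal (N + 1) by
          rw [ENNReal.ofReal_add hN'.le zero_le_one]; simp, ← ENNReal.ofReal_mul (by positivity)]
        refine ENNReal.ofReal_le_ofReal ?_
        rw [div_pow, mul_div_assoc', div_le_div_iff₀ (by positivity) (by positivity)]
        have h1 : (1 : ℝ) ≤ N := by exact_mod_cast hN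
        nlinarith [mul_nonneg (sub_nonneg.mpr h1) (sq_nonneg (N : ℝ))]

/-- If the Jacobian of the transport map is at most `Λ`, points are moved by at least a definite
distance. -/
theorem lt_norm_sub_logTransport {u : S2 → ℝ} (hu : IsC2 u) (hc : CConvex .logarithmic u) {Λ : ℝ}
    (hΛ : 0 ≤ Λ) (hJ : ∀ x : S2, extJac u x ≤ Λ) {N : ℕ} (hN : 0 < N)
    (hNΛ : 16 / (N : ℝ) ^ 2 * (1 + Λ) < 1) (x₀ : S2) :
    1 / (N : ℝ) ^ 2 < 2 * ‖(x₀ : E3) - logTransport u x₀‖ := by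
  by_contra! hε
  have hN' : (0 : ℝ) < N := by exact_mod_cast hN
  set y₀ := logTransport u x₀ with hy₀
  set K := capCone y₀ (1 / N) with hK
  -- Choose a preimage `x` of each direction. If `x` is within `1/N` of `y₀`, the point lies in the
  -- image of `K`. Otherwise monotonicity and `2‖x₀ - y₀‖ ≤ 1/N²` put `T x` within `1/N` of `x₀`.
  have hcov : pBall ⊆ capCone x₀ (1 / N) ∪ extTransport u '' K := by
    intro z hz
    have hz' := mem_pBall.mp hz
    obtain ⟨x, hx⟩ := surjective_logTransport hu (nrm z)
    by_cases hxy : ‖(x : E3) - y₀‖ ≤ 1 / N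
    · refine Or.inr ⟨‖z‖ • (x : E3), ⟨?_, ?_⟩, ?_⟩
      · rw [mem_pBall, norm_smul, norm_norm, norm_S2, mul_one]
        exact ⟨hz'.1, smul_ne_zero (norm_ne_zero_iff.mpr hz'.2) (ne_zero_S2 x)⟩
      · rw [mem_ofPred_eq, nrm_smul_S2 _ (norm_pos_iff.mpr hz'.2)]
        exact hxy
      · rw [extTransport_smul u (ne_zero_S2 x) (norm_pos_iff.mpr hz'.2), extTransport_coe, hx,
          norm_smul_nrm hz'.2]
    · refine Or.inl ⟨hz, ?_⟩
      push Not at hxy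
      have hmono := logTransport_monotone hu hc x₀ x
      rw [hx, ← hy₀] at hmono
      rw [mem_ofPred_eq, norm_sub_rev]
      have h2 : ‖(x : E3) - (nrm z : E3)‖ ≤ 2 := by
        refine (norm_sub_le _ _).trans ?_
        rw [norm_S2, norm_S2]; norm_num
      by_contra! h3
      have h4 : (1 / (N : ℝ)) * (1 / N) < ‖(x : E3) - y₀‖ * ‖(x₀ : E3) - (nrm z : E3)‖ :=
        mul_lt_mul'' hxy h3 (by positivity) (by positivity)
      have h5 : ‖(x₀ : E3) - y₀‖ * ‖(x : E3) - (nrm z : E3)‖ ≤ ‖(x₀ : E3) - y₀‖ * 2 := by gcongr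
      have h6 : (1 / (N : ℝ)) * (1 / N) = 1 / (N : ℝ) ^ 2 := by field_simp
      linarith
  set b := volume (Metric.ball (0 : E3) 1) with hb
  have hb0 : b ≠ 0 := (Metric.measure_ball_pos _ _ one_pos).ne'
  have hbt : b ≠ ⊤ := measure_ball_lt_top.ne
  have hpB : volume pBall = b := by
    rw [pBall, measure_sdiff_null (measure_singleton _)]
  have himg : volume (extTransport u '' K) ≤ ENNReal.ofReal Λ * volume K := by
    refine (addHaar_image_le_lintegral_abs_det_fderiv volume (measurableSet_capCone _ _)
      (fun z hz => hasFDerivWithinAt_extTransport hu K (mem_pBall.mp hz.1).2)).trans ?_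
    rw [← setLIntegral_const]
    refine setLIntegral_mono' (measurableSet_capCone _ _) fun z hz => ?_
    refine ENNReal.ofReal_le_ofReal ?_
    exact (extJac_nrm hu (mem_pBall.mp hz.1).2).le.trans (hJ _)
  have hfin : b ≤ ENNReal.ofReal (16 / (N : ℝ) ^ 2 * (1 + Λ)) * b := by
    calc b = volume pBall := hpB.symm
      _ ≤ volume (capCone x₀ (1 / N)) + volume (extTransport u '' K) :=
        (measure_mono hcov).trans (measure_union_le _ _)
      _ ≤ ENNReal.ofReal (16 / (N : ℝ) ^ 2) * b
          + ENNReal.ofReal Λ * (ENNReal.ofReal (16 / (N : ℝ) ^ 2) * b) := by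
        refine add_le_add (volume_capCone_le _ hN) (himg.trans ?_)
        gcongr
        exact volume_capCone_le _ hN
      _ = _ := by
        rw [ENNReal.ofReal_mul (by positivity), ENNReal.ofReal_add zero_le_one hΛ,
          ENNReal.ofReal_one]
        ring
  have hlt : ENNReal.ofReal (16 / (N : ℝ) ^ 2 * (1 + Λ)) * b < 1 * b :=
    ENNReal.mul_lt_mul_left hb0 hbt (by rwa [ENNReal.ofReal_lt_one])
  rw [one_mul] at hlt
  exact absurd hfin hlt.not_ge

/-- The explicit gradient is the tangential part of `T x`, of norm at most one, divided by `‖x - T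
x‖²`. -/
theorem norm_surfGrad_le {u : S2 → ℝ} (hu : IsC2 u) (hc : CConvex .logarithmic u) (x : S2) :
    ‖surfGrad u x‖ ≤ (‖(x : E3) - logTransport u x‖ ^ 2)⁻¹ := by
  have hcon := logContact_logTransport hu hc x
  rw [(logTransport_of_isLocalMin hu hcon.ne hcon.isLocalMin).1, norm_smul, norm_neg, norm_inv,
    norm_sub_sq_S2, Real.norm_of_nonneg (two_sub_inner_pos hcon.ne).le]
  refine mul_le_of_le_one_right (inv_nonneg.mpr (two_sub_inner_pos hcon.ne).le) ?_
  rw [← sq_le_one_iff₀ (norm_nonneg _), norm_sq_tanPart]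
  linarith [sq_nonneg (inner ℝ (x : E3) (logTransport u x : E3))]

theorem exists_isGradientBound {f₁ f₂ : S2 → ℝ} (h1 : Continuous f₁) {m : ℝ} (hm : 0 < m)
    (hf₂ : ∀ x, m ≤ f₂ x) : ∃ C, IsGradientBound .logarithmic f₁ f₂ C := by
  obtain ⟨M, hM⟩ : ∃ M : ℝ, 0 ≤ M ∧ ∀ x, f₁ x ≤ M := by
    obtain ⟨M, hM⟩ := isCompact_univ.bddAbove_image h1.continuousOn
    exact ⟨max M 0, le_max_right _ _, fun x =>
      (hM (mem_image_of_mem _ (mem_univ x))).trans (le_max_left _ _)⟩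
  set Λ := M / m with hΛ
  have hΛ0 : 0 ≤ Λ := div_nonneg hM.1 hm.le
  -- This `N` satisfies `16(1 + Λ) < N ≤ N²`, so the two caps cannot fill the ball. Then `‖x - T x‖
  -- > 1/(2N²)`, whence the constant `(2N²)²`, which depends only on an upper bound of `f₁` and on
  -- `m`.
  obtain ⟨N, hN⟩ := exists_nat_gt (16 * (1 + Λ))
  have hN1 : (1 : ℝ) < N := by linarith
  have hN0 : 0 < N := by
    have : (0 : ℝ) < N := by linarith
    exact_mod_cast this
  have hNΛ : 16 / (N : ℝ) ^ 2 * (1 + Λ) < 1 := by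
    rw [div_mul_eq_mul_div, div_lt_one (by positivity)]
    nlinarith
  refine ⟨(2 * (N : ℝ) ^ 2) ^ 2, fun u hu hc hsol x => ?_⟩
  have hJ : ∀ x : S2, extJac u x ≤ Λ := fun x => by
    have h := (opF_eq_zero_iff hu hc f₁ (fun y => hm.trans_le (hf₂ y)) x).mp (hsol x)
    rw [hΛ, le_div_iff₀ hm]
    calc extJac u x * m ≤ extJac u x * f₂ (logTransport u x) := by
          gcongr
          · exact abs_nonneg _
          · exact hf₂ _
      _ = f₁ x := h.symm
      _ ≤ M := hM.2 x
  have hlt := lt_norm_sub_logTransport hu hc hΛ0 hJ hN0 hNΛ x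
  refine (norm_surfGrad_le hu hc x).trans ?_
  rw [← inv_pow]
  gcongr
  refine inv_le_of_inv_le₀ (by positivity) ?_
  rw [mul_inv, ← one_div ((N : ℝ) ^ 2)]
  linarith

/-! ### Equivalence for the logarithmic cost. -/

theorem solvesOT_iff_solvesModified_logarithmic {d : Matrix (Fin 2) (Fin 2) ℝ → ℝ}
    (hd : IsDetPlus d) {f₁ f₂ : S2 → ℝ} (h1 : Continuous f₁) (h2 : Continuous f₂)
    (hf₂ : ∀ x, 0 < f₂ x) (hmass : ∫ x, f₁ x ∂surfMeasure = ∫ y, f₂ y ∂surfMeasure)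
    {C R : ℝ} (hC : IsGradientBound .logarithmic f₁ f₂ C) (hR : C < R) {u : S2 → ℝ} (hu : IsC2 u)
    (hc : CConvex .logarithmic u) :
    SolvesOT .logarithmic f₁ f₂ u ↔ SolvesModified d R .logarithmic f₁ f₂ u := by
  constructor
  · intro h x
    rw [opFPlus_eq hd (logarithmic_posSemidef hu hc x), h x]
    exact max_eq_left (by linarith [hC u hu hc h x])
  -- The gradient bound is not available here, since `u` is not yet known to solve (1). Only `F ≤ 0`
  -- is extracted from the maximum, and mass balance upgrades it to equality.
  · intro h x
    rw [opF_eq_zero_iff hu hc f₁ hf₂]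
    refine jacobian_eq_of_le hu hc h1 h2 (fun x => (hf₂ x).le) hmass (fun x => ?_) x
    rw [← opF_le_zero_iff hu hc f₁ hf₂, ← opFPlus_eq hd (logarithmic_posSemidef hu hc x)]
    exact (le_max_left _ _).trans (h x).le

end SphereOT

end

open SphereOT
theorem mainTheorem3 (f₁ f₂ : S2 → ℝ)
    (hf₁ : ∀ x, 0 ≤ f₁ x)
    (hf₂ : ∃ m : ℝ, 0 < m ∧ ∀ x, m ≤ f₂ x)
    (hmass : ∫ x, f₁ x ∂surfMeasure = ∫ y, f₂ y ∂surfMeasure)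
    (hreg₁ : IsC11 f₁) (hreg₂ : IsC11 f₂)
    (detPlus : Matrix (Fin 2) (Fin 2) ℝ → ℝ) (hdet : IsDetPlus detPlus) :
    (∀ R : ℝ, Real.pi < R → ∀ u : S2 → ℝ, IsC2 u → CConvex .sqGeodesic u →
      (SolvesOT .sqGeodesic f₁ f₂ u ↔ SolvesModified detPlus R .sqGeodesic f₁ f₂ u)) ∧
    (∃ C : ℝ, IsGradientBound .logarithmic f₁ f₂ C) ∧
    (∀ C : ℝ, IsGradientBound .logarithmic f₁ f₂ C →
      ∀ R : ℝ, C < R → ∀ u : S2 → ℝ, IsC2 u → CConvex .logarithmic u →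
      (SolvesOT .logarithmic f₁ f₂ u ↔ SolvesModified detPlus R .logarithmic f₁ f₂ u)) := by
  obtain ⟨m, hm, hfm⟩ := hf₂
  have h1 : Continuous f₁ := hreg₁.1.continuous
  have h2 : Continuous f₂ := hreg₂.1.continuous
  exact ⟨fun R hR u hu hc => solvesOT_iff_solvesModified_sqGeodesic hdet f₁ f₂ hR hu hc,
    exists_isGradientBound h1 hm hfm,
    fun C hC R hR u hu hc => solvesOT_iff_solvesModified_logarithmic hdet h1 h2
      (fun x => hm.trans_le (hfm x)) hmass hC hR hu hc⟩
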